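/- Let $G$ be a locally compact second countable Hausdorff Abelian group, written multiplicatively, and let $H\subset G$ be a closed cocompact subgroup. Let $\lambda$ be a Haar measure on $G/H$, let $s:G/H\to G$ be a Borel cross-section of the natural projection $G\to G/H$ with $s(H)=1$, and put $h(g,y)=s(gy)^{-1}\,g\,s(y)\in H$ for $g\in G$, $y\in G/H$. Let $V=(V_h)_{h\in H}$ be a strongly continuous unitary representation of $H$ in a separable complex Hilbert space $\mathcal H$, and let $U=(U_g)_{g\in G}$ be the representation of $G$ induced by $V$, i.e. the unitary representation in $L^2(G/H,\lambda;\mathcal H)=L^2(G/H,\lambda)\otimes\mathcal H$ given by $$(U_{g^{-1}}f)(y)=V_{h(g,y)}^{-1}\bigl(f(gy)\bigr),\qquad g\in G,\ y\in G/H .$$ For a unitary representation $W$ of a locally compact second countable Abelian group $A$ in a separable Hilbert space, the spectral measure of a vector $x$ is the finite Borel measure $\mu_x$ on the dual group $\widehat A$ with $\langle W_a x,x\rangle=\int_{\widehat A}\chi(a)\,d\mu_x(\chi)$ for all $a\in A$. A Borel measure $\sigma$ on $\widehat A$ is a measure of maximal spectral type of $W$ if $\mu_x\ll\sigma$ for every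 vector $x$ and $\sigma$ has the same null sets as $\mu_x$ for some vector $x$. A multiplicity function of $W$ is a Borel function $l:\widehat A\to\{0,1,2,\dots,\infty\}$ for which there are vectors $x_0,x_1,\dots$ such that the space is the orthogonal sum of the $W$-cyclic subspaces generated by them and, for every $n$, $\mu_{x_n}$ has the same null sets as the restriction of $\sigma$ to $\{l>n\}$, where $\sigma$ is a measure of maximal spectral type. The set of spectral multiplicities of $W$ is the essential image of $l$, i.e. the set of all $k$ with $\sigma(\{l=k\})>0$ (it does not depend on the choices and never contains $0$). Let $\pi:\widehat G\to\widehat H$ be the natural projection $\chi\mapsto\chi|_H$. Then: (i) if $\sigma_U$ is a measure of maximal spectral type of $U$, then $\sigma_U\circ\pi^{-1}$ is a measure of maximal spectral type of $V$; (ii) $U$ and $V$ have the same set of spectral multiplicities. -/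

import Mathlib

open MeasureTheory Topology
open scoped ENNReal

noncomputable section

/-! ### Unitary representations and their spectral invariants -/

/-- A unitary representation of a topological group `G` in a complex Hilbert space `E`: a
homomorphism into the group of unitary operators which is continuous for the strong operator
topology. -/
structure UnitaryRep (G : Type*) [Group G] [TopologicalSpace G]
    (E : Type*) [NormedAddCommGroup E] [InnerProductSpace ℂ E] where
  /-- the underlying homomorphism into the unitary group -/
  toHom : G →* (E ≃ₗᵢ[ℂ] E)
  /-- strong continuity -/
  continuous_orbit : ∀ x : E, Continuous fun g => toHom g x

/-- The dual group carries its Borel `σ`-algebra (for the compact-open topology). -/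
instance instMeasurableSpacePontryaginDual (G : Type*) [Monoid G] [TopologicalSpace G] :
    MeasurableSpace (PontryaginDual G) := borel _

instance instBorelSpacePontryaginDual (G : Type*) [Monoid G] [TopologicalSpace G] :
    BorelSpace (PontryaginDual G) := ⟨rfl⟩

/-- Two measures are equivalent if they have the same null sets. -/
def MeasureEquivalent {α : Type*} [MeasurableSpace α] (μ ν : Measure α) : Prop :=
  μ ≪ ν ∧ ν ≪ μ

namespace UnitaryRep

variable {G : Type*} [CommGroup G] [TopologicalSpace G]
  {E : Type*} [NormedAddCommGroup E] [InnerProductSpace ℂ E]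

/-- `μ` is the spectral measure of the vector `x`: the finite Borel measure on the dual group with
`⟨U_g x, x⟩ = ∫ χ(g) dμ(χ)` for all `g`. (The inner product `inner ℂ x y` of Mathlib is linear in
the second variable, so `⟨U_g x, x⟩` is `inner ℂ x (U_g x)`.) -/
def IsSpectralMeasure (U : UnitaryRep G E) (x : E) (μ : Measure (PontryaginDual G)) : Prop :=
  IsFiniteMeasure μ ∧ ∀ g : G, inner ℂ x (U.toHom g x) = ∫ χ, ((χ g : Circle) : ℂ) ∂μ

/-- `σ` is a measure of maximal spectral type of `U`: the spectral measure of every vector is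
absolutely continuous with respect to `σ`, and `σ` is equivalent to the spectral measure of some
vector. -/
def IsMaximalSpectralType (U : UnitaryRep G E) (σ : Measure (PontryaginDual G)) : Prop :=
  (∀ x : E, ∃ μ, U.IsSpectralMeasure x μ ∧ μ ≪ σ) ∧
    ∃ (x : E) (μ : Measure (PontryaginDual G)), U.IsSpectralMeasure x μ ∧ MeasureEquivalent μ σ

/-- The `U`-cyclic subspace generated by `x`: the closed linear span of its orbit. -/
def cyclicSubspace (U : UnitaryRep G E) (x : E) : Submodule ℂ E :=
  (Submodule.span ℂ (Set.range fun g : G => U.toHom g x)).topologicalClosure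

/-- `l` is a spectral multiplicity function of `U`, relative to the measure `σ` of maximal spectral
type: the Hilbert space is the orthogonal sum of the cyclic subspaces of vectors `x 0, x 1, …`, and
the spectral measure of `x n` is equivalent to the restriction of `σ` to `{χ | n < l χ}`. -/
def IsMultiplicityFunction (U : UnitaryRep G E) (σ : Measure (PontryaginDual G))
    (l : PontryaginDual G → ℕ∞) : Prop :=
  Measurable l ∧ ∃ x : ℕ → E,
    (Pairwise fun m n => U.cyclicSubspace (x m) ⟂ U.cyclicSubspace (x n)) ∧
    (⨆ n, U.cyclicSubspace (x n)).topologicalClosure = ⊤ ∧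
    ∀ n : ℕ, ∃ μ, U.IsSpectralMeasure (x n) μ ∧
      MeasureEquivalent μ (σ.restrict {χ | (n : ℕ∞) < l χ})

/-- The set of spectral multiplicities of `U`: the essential image of its multiplicity function,
that is, the set of values taken on a set of positive measure for the maximal spectral type. -/
def spectralMultiplicities (U : UnitaryRep G E) : Set ℕ∞ :=
  {k | ∃ (σ : Measure (PontryaginDual G)) (l : PontryaginDual G → ℕ∞),
    U.IsMaximalSpectralType σ ∧ U.IsMultiplicityFunction σ l ∧ σ {χ | l χ = k} ≠ 0}

end UnitaryRep

/-! ### Induced representations -/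

/-- The natural projection of dual groups: restriction of characters of `G` to the subgroup `H`. -/
def dualRestriction {G : Type*} [CommGroup G] [TopologicalSpace G] (H : Subgroup G) :
    PontryaginDual G →ₜ* PontryaginDual H :=
  PontryaginDual.map ⟨H.subtype, continuous_subtype_val⟩

/-- A Borel cross-section of the natural projection `G → G ⧸ H` which sends the coset `H` to the
neutral element. -/
structure BorelCrossSection {G : Type*} [Group G] [MeasurableSpace G] (H : Subgroup G) where
  toFun : G ⧸ H → G
  measurable_toFun : Measurable toFun
  mk_toFun : ∀ y, (toFun y : G ⧸ H) = y
  toFun_one : toFun ((1 : G) : G ⧸ H) = 1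

namespace BorelCrossSection

variable {G : Type*} [CommGroup G] [MeasurableSpace G] {H : Subgroup G}

/-- The cocycle `h(g, y) = s(gy)⁻¹ g s(y)` with values in `H`. -/
def cocycle (s : BorelCrossSection H) (g : G) (y : G ⧸ H) : H :=
  ⟨(s.toFun (g • y))⁻¹ * g * s.toFun y, by
    rw [mul_assoc, ← QuotientGroup.eq, s.mk_toFun, ← smul_eq_mul, ← MulAction.Quotient.smul_coe,
      s.mk_toFun]⟩

theorem cocycle_mul (s : BorelCrossSection H) (g₁ g₂ : G) (y : G ⧸ H) :
    s.cocycle (g₁ * g₂) y = s.cocycle g₁ (g₂ • y) * s.cocycle g₂ y := by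
  ext
  simp only [cocycle, Subgroup.coe_mul, mul_smul]
  group

theorem cocycle_one (s : BorelCrossSection H) (y : G ⧸ H) : s.cocycle 1 y = 1 := by
  ext
  simp [cocycle]

end BorelCrossSection

theorem polishSpace_of_locallyCompact_group (G : Type*) [CommGroup G] [TopologicalSpace G]
    [IsTopologicalGroup G] [LocallyCompactSpace G] [SecondCountableTopology G] [T2Space G] :
    PolishSpace G := by
  let _ := IsTopologicalGroup.rightUniformSpace G
  have := isUniformGroup_of_commGroup (G := G)
  have : CompleteSpace G := IsRightUniformGroup.completeSpace_of_weaklyLocallyCompactSpace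
  have : (uniformity G).IsCountablyGenerated := by
    rw [uniformity_eq_comap_nhds_one]
    infer_instance
  have : TopologicalSpace.IsCompletelyMetrizableSpace G := inferInstance
  constructor

namespace UnitaryRep

theorem continuous_uncurry {G : Type*} [Group G] [TopologicalSpace G]
    {E : Type*} [NormedAddCommGroup E] [InnerProductSpace ℂ E] (V : UnitaryRep G E) :
    Continuous fun p : G × E => V.toHom p.1 p.2 := by
  rw [continuous_iff_continuousAt]
  rintro ⟨g, x⟩
  rw [ContinuousAt, tendsto_iff_norm_sub_tendsto_zero]
  have h1 : Filter.Tendsto (fun p : G × E => ‖p.2 - x‖ + ‖V.toHom p.1 x - V.toHom g x‖)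
      (𝓝 (g, x)) (𝓝 0) := by
    have : Continuous fun p : G × E => ‖p.2 - x‖ + ‖V.toHom p.1 x - V.toHom g x‖ := by
      have := (V.continuous_orbit x).comp (continuous_fst (X := G) (Y := E))
      simp only [Function.comp_def] at this
      fun_prop
    simpa using this.tendsto (g, x)
  refine squeeze_zero (fun _ => norm_nonneg _) (fun p => ?_) h1
  calc ‖V.toHom p.1 p.2 - V.toHom g x‖
      = ‖V.toHom p.1 (p.2 - x) + (V.toHom p.1 x - V.toHom g x)‖ := by rw [map_sub]; abel_nf
    _ ≤ _ := (norm_add_le _ _).trans (by rw [LinearIsometryEquiv.norm_map])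

/-- A measurable homomorphism into the unitary group of a separable Hilbert space is strongly
continuous. -/
theorem continuous_of_measurable_norm_sub {G : Type*} [CommGroup G] [TopologicalSpace G]
    [MeasurableSpace G] [IsTopologicalGroup G] [LocallyCompactSpace G]
    [SecondCountableTopology G] [T2Space G] [BorelSpace G]
    {F : Type*} [NormedAddCommGroup F] [InnerProductSpace ℂ F] [SecondCountableTopology F]
    (W : G →* (F ≃ₗᵢ[ℂ] F)) (f : F) (hmeas : Measurable fun g : G => ‖W g f - f‖ₑ) :
    Continuous fun g : G => W g f := by
  have key : ∀ a b : G, ‖W (a⁻¹ * b) f - f‖ₑ = ‖W b f - W a f‖ₑ := by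
    intro a b
    have h1 : W a (W (a⁻¹ * b) f - f) = W b f - W a f := by
      have h2 : W b f = W a (W (a⁻¹ * b) f) := by
        conv_lhs => rw [← mul_inv_cancel_left a b, map_mul]
        rw [LinearIsometryEquiv.coe_mul, Function.comp_apply]
      rw [map_sub, h2]
    rw [← h1, LinearIsometryEquiv.enorm_map]
  -- the sets of almost-invariance have positive Haar measure
  have hpos : ∀ ε : ℝ≥0∞, 0 < ε → 0 < Measure.haar {g : G | ‖W g f - f‖ₑ < ε} := by
    intro ε hε
    rw [pos_iff_ne_zero]
    intro h0
    let R := Set.range fun g : G => W g f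
    have : Nonempty R := ⟨⟨_, 1, rfl⟩⟩
    choose γ hγ using fun n : ℕ => (TopologicalSpace.denseSeq R n).2
    have hγ' : ∀ n, W (γ n) f = TopologicalSpace.denseSeq R n := hγ
    have hcov : (Set.univ : Set G) ⊆
        ⋃ n, (fun g : G => (γ n)⁻¹ * g) ⁻¹' {g : G | ‖W g f - f‖ₑ < ε} := by
      intro g _
      obtain ⟨n, hn⟩ := (TopologicalSpace.denseRange_denseSeq R).exists_mem_open
        (Metric.isOpen_eball (x := (⟨W g f, g, rfl⟩ : R)) (ε := ε))
        ⟨_, Metric.mem_eball_self hε⟩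
      refine Set.mem_iUnion.2 ⟨n, ?_⟩
      rw [Set.mem_preimage, Set.mem_ofPred_eq, key, hγ' n, ← edist_eq_enorm_sub, edist_comm]
      exact hn
    have hz : Measure.haar (Set.univ : Set G) = 0 := by
      refine measure_mono_null hcov (measure_iUnion_null fun n => ?_)
      rw [measure_preimage_mul]
      exact h0
    exact (isOpen_univ.measure_pos Measure.haar Set.univ_nonempty).ne' hz
  have hnhds : ∀ ε : ℝ≥0∞, 0 < ε → {g : G | ‖W g f - f‖ₑ < ε} ∈ 𝓝 (1 : G) := by
    intro ε hε
    have hm : MeasurableSet {g : G | ‖W g f - f‖ₑ < ε / 2} :=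
      measurableSet_lt hmeas measurable_const
    have h2 : 0 < ε / 2 := ENNReal.half_pos hε.ne'
    refine Filter.mem_of_superset
      (Measure.div_mem_nhds_one_of_haar_pos Measure.haar _ hm (hpos _ h2)) ?_
    rintro _ ⟨a, ha, b, hb, rfl⟩
    have h3 : ∀ c : G, ‖W c⁻¹ f - f‖ₑ = ‖W c f - f‖ₑ := by
      intro c
      have := key c 1
      rw [mul_one, map_one] at this
      rw [this, ← edist_eq_enorm_sub, edist_comm, edist_eq_enorm_sub, LinearIsometryEquiv.coe_one, id]
    have h4 : ‖W (a / b) f - f‖ₑ = ‖W b⁻¹ f - W a⁻¹ f‖ₑ := by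
      rw [← key a⁻¹ b⁻¹, inv_inv, div_eq_mul_inv]
    rw [Set.mem_ofPred_eq, h4]
    calc ‖W b⁻¹ f - W a⁻¹ f‖ₑ = ‖(W b⁻¹ f - f) - (W a⁻¹ f - f)‖ₑ := by rw [sub_sub_sub_cancel_right]
      _ ≤ ‖W b⁻¹ f - f‖ₑ + ‖W a⁻¹ f - f‖ₑ := enorm_sub_le
      _ < ε / 2 + ε / 2 := by rw [h3, h3]; exact ENNReal.add_lt_add hb ha
      _ = ε := ENNReal.add_halves ε
  rw [continuous_iff_continuousAt]
  intro g
  rw [ContinuousAt, EMetric.tendsto_nhds]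
  intro ε hε
  have hc : Filter.Tendsto (fun b : G => g⁻¹ * b) (𝓝 g) (𝓝 1) := by
    have : Continuous fun b : G => g⁻¹ * b := by fun_prop
    simpa using this.tendsto g
  filter_upwards [hc (hnhds ε hε)] with b hb
  rw [edist_eq_enorm_sub, ← key g b]
  exact hb

section Induced

variable {G : Type*} [CommGroup G] [TopologicalSpace G] [MeasurableSpace G]
  {E : Type*} [NormedAddCommGroup E] [InnerProductSpace ℂ E]
  {H : Subgroup G}

/-- The operator of the induced representation, on functions `f : G ⧸ H → E`:
`(U_{g⁻¹} f)(y) = V_{h(g, y)}⁻¹ (f (gy))`. -/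
def inducedFun (s : BorelCrossSection H) (V : UnitaryRep H E) (g : G) (f : G ⧸ H → E) :
    G ⧸ H → E :=
  fun y => V.toHom (s.cocycle g⁻¹ y)⁻¹ (f (g⁻¹ • y))

theorem inducedFun_one (s : BorelCrossSection H) (V : UnitaryRep H E) (f : G ⧸ H → E) :
    inducedFun s V 1 f = f := by
  funext y
  simp [inducedFun, s.cocycle_one]

theorem inducedFun_mul (s : BorelCrossSection H) (V : UnitaryRep H E) (a b : G)
    (f : G ⧸ H → E) : inducedFun s V (a * b) f = inducedFun s V a (inducedFun s V b f) := by
  funext y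
  simp only [inducedFun]
  rw [mul_inv_rev, s.cocycle_mul, mul_inv_rev, mul_smul, map_mul]
  rfl

variable [IsTopologicalGroup G] [LocallyCompactSpace G] [SecondCountableTopology G] [T2Space G]
  [BorelSpace G] [IsClosed (H : Set G)]

theorem borelSpace_quotient : BorelSpace (G ⧸ H) := by
  have := polishSpace_of_locallyCompact_group G
  infer_instance

theorem measurePreserving_smul_quotient (ν : Measure (G ⧸ H)) [ν.IsHaarMeasure] (g : G) :
    MeasurePreserving (fun y : G ⧸ H => g • y) ν ν := by
  have : BorelSpace (G ⧸ H) := borelSpace_quotient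
  have h := measurePreserving_mul_left ν ((g : G) : G ⧸ H)
  convert h using 2 with y
  induction y using QuotientGroup.induction_on with
  | H a => rfl

theorem measurable_cocycle_uncurry (s : BorelCrossSection H) :
    Measurable fun p : G × (G ⧸ H) => s.cocycle p.1 p.2 := by
  have : BorelSpace (G ⧸ H) := borelSpace_quotient
  have h1 : Measurable fun p : G × (G ⧸ H) => p.1 • p.2 := continuous_smul.measurable
  refine Measurable.subtype_mk ?_
  exact ((s.measurable_toFun.comp h1).inv.mul measurable_fst).mul
    (s.measurable_toFun.comp measurable_snd)

theorem stronglyMeasurable_inducedFun_uncurry (s : BorelCrossSection H) (V : UnitaryRep H E)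
    {f : G ⧸ H → E} (hf : StronglyMeasurable f) :
    StronglyMeasurable fun p : G × (G ⧸ H) => inducedFun s V p.1 f p.2 := by
  have : BorelSpace (G ⧸ H) := borelSpace_quotient
  have h0 : Measurable fun p : G × (G ⧸ H) => (p.1⁻¹, p.2) := by fun_prop
  have h1 : Measurable fun p : G × (G ⧸ H) => p.1⁻¹ • p.2 :=
    (continuous_smul.measurable (α := G × (G ⧸ H))).comp h0
  have h2 : Measurable fun p : G × (G ⧸ H) => (s.cocycle p.1⁻¹ p.2)⁻¹ :=
    ((measurable_cocycle_uncurry s).comp h0).inv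
  have : TopologicalSpace.PseudoMetrizableSpace H :=
    have := polishSpace_of_locallyCompact_group G
    have : TopologicalSpace.PseudoMetrizableSpace G := inferInstance
    Topology.IsInducing.subtypeVal.pseudoMetrizableSpace
  exact V.continuous_uncurry.comp_stronglyMeasurable
    (h2.stronglyMeasurable.prodMk (hf.comp_measurable h1))

theorem stronglyMeasurable_inducedFun (s : BorelCrossSection H) (V : UnitaryRep H E) (g : G)
    {f : G ⧸ H → E} (hf : StronglyMeasurable f) : StronglyMeasurable (inducedFun s V g f) := by
  have h : Measurable fun y : G ⧸ H => (g, y) := measurable_prodMk_left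
  have h1 := (stronglyMeasurable_inducedFun_uncurry s V hf).comp_measurable h
  simpa only [Function.comp_def] using h1

variable (ν : Measure (G ⧸ H)) [ν.IsHaarMeasure]

theorem inducedFun_congr (s : BorelCrossSection H) (V : UnitaryRep H E) (g : G)
    {f f' : G ⧸ H → E} (h : f =ᵐ[ν] f') : inducedFun s V g f =ᵐ[ν] inducedFun s V g f' := by
  filter_upwards [(measurePreserving_smul_quotient ν g⁻¹).quasiMeasurePreserving.ae h] with y hy
  simp only [inducedFun]
  rw [hy]

theorem aestronglyMeasurable_inducedFun (s : BorelCrossSection H) (V : UnitaryRep H E) (g : G)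
    {f : G ⧸ H → E} (hf : AEStronglyMeasurable f ν) :
    AEStronglyMeasurable (inducedFun s V g f) ν :=
  ⟨_, stronglyMeasurable_inducedFun s V g hf.stronglyMeasurable_mk,
    inducedFun_congr ν s V g hf.ae_eq_mk⟩

theorem eLpNorm_inducedFun (s : BorelCrossSection H) (V : UnitaryRep H E) (g : G)
    {f : G ⧸ H → E} (hf : AEStronglyMeasurable f ν) :
    eLpNorm (inducedFun s V g f) 2 ν = eLpNorm f 2 ν := by
  rw [← eLpNorm_comp_measurePreserving hf (measurePreserving_smul_quotient ν g⁻¹)]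
  exact eLpNorm_congr_norm_ae (Filter.Eventually.of_forall fun y => by simp [inducedFun])

theorem memLp_inducedFun (s : BorelCrossSection H) (V : UnitaryRep H E) (g : G)
    {f : G ⧸ H → E} (hf : MemLp f 2 ν) : MemLp (inducedFun s V g f) 2 ν :=
  ⟨aestronglyMeasurable_inducedFun ν s V g hf.1, by
    rw [eLpNorm_inducedFun ν s V g hf.1]; exact hf.2⟩

/-- The operator `U_g` of the induced representation as a linear isometry of `L²(G ⧸ H, E)`. -/
def inducedIsometry (s : BorelCrossSection H) (V : UnitaryRep H E) (g : G) :
    Lp E 2 ν →ₗᵢ[ℂ] Lp E 2 ν where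
  toFun f := (memLp_inducedFun ν s V g (Lp.memLp f)).toLp _
  map_add' f f' := by
    rw [← MemLp.toLp_add]
    refine MemLp.toLp_congr _ _ ((inducedFun_congr ν s V g (Lp.coeFn_add f f')).trans ?_)
    exact Filter.Eventually.of_forall fun y => by simp [inducedFun]
  map_smul' c f := by
    rw [RingHom.id_apply, ← MemLp.toLp_const_smul]
    refine MemLp.toLp_congr _ _ ((inducedFun_congr ν s V g (Lp.coeFn_smul c f)).trans ?_)
    exact Filter.Eventually.of_forall fun y => by simp [inducedFun]
  norm_map' f := by
    simp only [LinearMap.coe_mk, AddHom.coe_mk]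
    rw [Lp.norm_toLp, eLpNorm_inducedFun ν s V g (Lp.memLp f).1, Lp.norm_def]

theorem coeFn_inducedIsometry (s : BorelCrossSection H) (V : UnitaryRep H E) (g : G)
    (f : Lp E 2 ν) : inducedIsometry ν s V g f =ᵐ[ν] inducedFun s V g f :=
  MemLp.coeFn_toLp (memLp_inducedFun ν s V g (Lp.memLp f))

theorem inducedIsometry_one (s : BorelCrossSection H) (V : UnitaryRep H E) (f : Lp E 2 ν) :
    inducedIsometry ν s V 1 f = f := by
  refine Lp.ext ((coeFn_inducedIsometry ν s V 1 f).trans ?_)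
  rw [inducedFun_one]

theorem inducedIsometry_mul (s : BorelCrossSection H) (V : UnitaryRep H E) (a b : G)
    (f : Lp E 2 ν) :
    inducedIsometry ν s V (a * b) f = inducedIsometry ν s V a (inducedIsometry ν s V b f) := by
  refine Lp.ext ((coeFn_inducedIsometry ν s V _ f).trans ?_)
  rw [inducedFun_mul]
  exact ((coeFn_inducedIsometry ν s V a _).trans
    (inducedFun_congr ν s V a (coeFn_inducedIsometry ν s V b f))).symm

/-- The induced representation as a homomorphism into the unitary group of `L²(G ⧸ H, E)`. -/
def inducedHom (s : BorelCrossSection H) (V : UnitaryRep H E) :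
    G →* (Lp E 2 ν ≃ₗᵢ[ℂ] Lp E 2 ν) where
  toFun g :=
    { toLinearEquiv := LinearEquiv.ofLinearMap (inducedIsometry ν s V g).toLinearMap
        (inducedIsometry ν s V g⁻¹).toLinearMap
        (by ext1 f; simp [← inducedIsometry_mul, inducedIsometry_one])
        (by ext1 f; simp [← inducedIsometry_mul, inducedIsometry_one])
      norm_map' := (inducedIsometry ν s V g).norm_map }
  map_one' := by
    ext1 f
    exact inducedIsometry_one ν s V f
  map_mul' a b := by
    ext1 f
    exact inducedIsometry_mul ν s V a b f

theorem inducedHom_apply (s : BorelCrossSection H) (V : UnitaryRep H E) (g : G) (f : Lp E 2 ν) :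
    inducedHom ν s V g f = inducedIsometry ν s V g f := rfl

variable [CompactSpace (G ⧸ H)]

theorem measurable_norm_inducedHom_sub (s : BorelCrossSection H) (V : UnitaryRep H E)
    (f : Lp E 2 ν) : Measurable fun g : G => ‖inducedHom ν s V g f - f‖ₑ := by
  have : BorelSpace (G ⧸ H) := borelSpace_quotient
  have hsm := Lp.stronglyMeasurable f
  have h : ∀ g : G, ‖inducedHom ν s V g f - f‖ₑ
      = (∫⁻ y, ‖inducedFun s V g f y - f y‖ₑ ^ (2 : ℝ) ∂ν) ^ (1 / (2 : ℝ)) := by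
    intro g
    have h1 : ((inducedHom ν s V g f - f : Lp E 2 ν) : G ⧸ H → E)
        =ᵐ[ν] fun y => inducedFun s V g f y - f y := by
      filter_upwards [Lp.coeFn_sub (inducedHom ν s V g f) f, coeFn_inducedIsometry ν s V g f]
        with y h1 h2
      rw [h1, Pi.sub_apply, inducedHom_apply, h2]
    rw [Lp.enorm_def, eLpNorm_congr_ae h1, eLpNorm_eq_lintegral_rpow_enorm_toReal (by simp) (by simp)]
    simp
  simp_rw [h]
  refine Measurable.pow_const ?_ _
  refine Measurable.lintegral_prod_right' (f := fun p : G × (G ⧸ H) =>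
    ‖inducedFun s V p.1 f p.2 - f p.2‖ₑ ^ (2 : ℝ)) ?_
  exact ((stronglyMeasurable_inducedFun_uncurry s V hsm).sub
    (hsm.comp_measurable measurable_snd)).enorm.pow_const _

variable [TopologicalSpace.SeparableSpace E]

theorem continuous_inducedHom (s : BorelCrossSection H) (V : UnitaryRep H E) (f : Lp E 2 ν) :
    Continuous fun g : G => inducedHom ν s V g f := by
  have : BorelSpace (G ⧸ H) := borelSpace_quotient
  have : Fact ((2 : ℝ≥0∞) ≠ ∞) := ⟨by simp⟩
  have hsec : SecondCountableTopology (Lp E 2 ν) := Lp.SecondCountableTopology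
  exact continuous_of_measurable_norm_sub (inducedHom ν s V) f
    (measurable_norm_inducedHom_sub ν s V f)

/-- The representation of `G` induced by the representation `V` of the closed cocompact
subgroup `H`, acting on `L²(G ⧸ H, ν; E) = L²(G ⧸ H, ν) ⊗ E` by
`(U_{g⁻¹} f)(y) = V_{h(g, y)}⁻¹ (f (gy))`. -/
def induced (s : BorelCrossSection H) (V : UnitaryRep H E) : UnitaryRep G (Lp E 2 ν) where
  toHom := inducedHom ν s V
  continuous_orbit := continuous_inducedHom ν s V

end Induced

end UnitaryRep

end

noncomputable section

/-! ### The dual group of a locally compact second countable group -/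

namespace PontryaginDual

open BoundedContinuousFunction

variable {G : Type*} [CommGroup G] [TopologicalSpace G]

/-! Let `π` be the restriction map of dual groups and `H^⊥` its kernel. Since `G ⧸ H` is compact,
`H^⊥` is discrete, hence countable, and `π` has a Borel section `t`. The operators `(β ↦
t(β)(g))(V)` then extend `V` to a representation `W` of `G` on the same space, and the spectral
measure of `x` for `W` is the image under `t` of the one for `V`. Inducing the restriction of a
representation of `G` tensors it with `L²(G ⧸ H)`, which is spanned by the characters in `H^⊥`. Thus
`U` is the orthogonal sum of the representations `χ ⊗ W`, `χ ∈ H^⊥`, embedded by `x ↦ c χ(s(y))⁻¹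
W_{s(y)}⁻¹ x`, where `c` is a normalizing constant.

Consequently the spectral measure of a vector of `U` is the sum over `χ` of the spectral measures
for `V` of its components, carried to `Ĝ` by `β ↦ χ t(β)`. The sets `χ t(Ĥ)` are Borel and partition
`Ĝ`, and `π` maps each of them bijectively onto `Ĥ`. Over every piece one sees a copy of `V`:
cutting a maximal spectral type or a multiplicity function of `U` down to a piece gives one of `V`.
Conversely, the sum of the copies of a maximal spectral type of `V` is one for `U`, with
multiplicity function `l ∘ π`. Both assertions follow.

The analytic inputs are: injectivity of the Fourier transform of finite measures
(`PontryaginDual.measure_ext`), which yields the functional calculus for unimodular functions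
(`exists_calculus`); totality of joint eigenvectors for a representation that is scalar on `H`
(`eq_zero_of_forall_joint_eigenvector`), which yields both the extension of characters from `H` to
`G` and the totality of `H^⊥` in `L²(G ⧸ H)`; and the Lusin–Souslin theorem for the Borel section.

Bochner's theorem is not needed. Each assertion starts from a measure of maximal spectral type of
`U` or of `V`, which includes spectral measures of all vectors; those of `U` pass to `V` through
constant functions. -/

theorem continuous_eval_const (g : G) : Continuous fun χ : PontryaginDual G => χ g :=
  ContinuousEvalConst.continuous_eval_const (F := ContinuousMonoidHom G Circle) g

theorem continuous_coe_eval_const (g : G) :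
    Continuous fun χ : PontryaginDual G => ((χ g : Circle) : ℂ) :=
  continuous_induced_dom.comp (continuous_eval_const g)

theorem measurable_coe_eval_const (g : G) :
    Measurable fun χ : PontryaginDual G => ((χ g : Circle) : ℂ) :=
  (continuous_coe_eval_const g).measurable

theorem coe_inv_apply (χ : PontryaginDual G) (g : G) :
    ((χ g⁻¹ : Circle) : ℂ) = star ((χ g : Circle) : ℂ) := by
  rw [map_inv, Circle.coe_inv_eq_conj]
  rfl

instance secondCountableTopology [LocallyCompactSpace G] [SecondCountableTopology G] :
    SecondCountableTopology (PontryaginDual G) :=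
  (ContinuousMonoidHom.isInducing_toContinuousMap G Circle).secondCountableTopology

instance polishSpace [IsTopologicalGroup G] [LocallyCompactSpace G] [SecondCountableTopology G] :
    PolishSpace (PontryaginDual G) :=
  polishSpace_of_locallyCompact_group _

/-- Evaluation of characters at `g`, as a bounded continuous function on the dual group. -/
def evalBCF (g : G) : PontryaginDual G →ᵇ ℂ :=
  BoundedContinuousFunction.ofNormedAddCommGroup (fun χ => ((χ g : Circle) : ℂ))
    (continuous_coe_eval_const g) 1 fun χ => (Circle.norm_coe (χ g)).le

theorem evalBCF_apply (g : G) (χ : PontryaginDual G) : evalBCF g χ = ((χ g : Circle) : ℂ) := rfl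

theorem evalBCF_mul (g g' : G) : evalBCF (g * g') = evalBCF g * evalBCF g' := by
  ext χ
  simp [evalBCF_apply]

/-- The algebra of trigonometric polynomials on the dual group. -/
def trigPoly (G : Type*) [CommGroup G] [TopologicalSpace G] :
    StarSubalgebra ℂ (PontryaginDual G →ᵇ ℂ) where
  carrier := Submodule.span ℂ (Set.range (evalBCF (G := G)))
  mul_mem' {a b} ha hb := by
    have h := Submodule.mul_mem_mul ha hb
    rw [Submodule.span_mul_span] at h
    refine Submodule.span_mono ?_ h
    rintro _ ⟨_, ⟨g, rfl⟩, _, ⟨g', rfl⟩, rfl⟩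
    exact ⟨g * g', evalBCF_mul g g'⟩
  add_mem' := Submodule.add_mem _
  algebraMap_mem' c := by
    have h : algebraMap ℂ (PontryaginDual G →ᵇ ℂ) c = c • evalBCF (1 : G) := by
      ext χ
      simp [evalBCF_apply, BoundedContinuousFunction.algebraMap_apply]
    rw [h]
    exact Submodule.smul_mem _ _ (Submodule.subset_span ⟨1, rfl⟩)
  star_mem' {a} ha := by
    induction ha using Submodule.span_induction with
    | mem x hx =>
      obtain ⟨g, rfl⟩ := hx
      refine Submodule.subset_span ⟨g⁻¹, ?_⟩
      ext χ
      exact coe_inv_apply χ g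
    | zero => rw [star_zero]; exact Submodule.zero_mem _
    | add x y _ _ hx hy => rw [star_add]; exact Submodule.add_mem _ hx hy
    | smul c x _ hx => rw [star_smul]; exact Submodule.smul_mem _ _ hx

theorem separatesPoints_trigPoly :
    ((trigPoly G).map (toContinuousMapStarₐ ℂ)).SeparatesPoints := by
  intro χ ψ h
  obtain ⟨g, hg⟩ : ∃ g, χ g ≠ ψ g := by
    by_contra! h'
    exact h (PontryaginDual.ext h')
  refine ⟨_, ⟨_, ⟨evalBCF g, Submodule.subset_span ⟨g, rfl⟩, rfl⟩, rfl⟩, ?_⟩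
  simpa [evalBCF_apply, Circle.coe_inj] using! hg

theorem integrable_coe_eval (μ : Measure (PontryaginDual G)) [IsFiniteMeasure μ] (g : G) :
    Integrable (fun χ : PontryaginDual G => ((χ g : Circle) : ℂ)) μ :=
  Integrable.of_bound (measurable_coe_eval_const g).aestronglyMeasurable 1
    (Filter.Eventually.of_forall fun χ => (Circle.norm_coe (χ g)).le)

variable [IsTopologicalGroup G] [LocallyCompactSpace G] [SecondCountableTopology G]

/-- A finite Borel measure on the dual group is determined by its Fourier transform. -/
theorem measure_ext {μ μ' : Measure (PontryaginDual G)} [IsFiniteMeasure μ] [IsFiniteMeasure μ']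
    (h : ∀ g : G, ∫ χ, ((χ g : Circle) : ℂ) ∂μ = ∫ χ, ((χ g : Circle) : ℂ) ∂μ') : μ = μ' := by
  -- On a Polish space, integrals over a point-separating star subalgebra of bounded continuous
  -- functions determine a finite measure; here the algebra is that of trigonometric polynomials.
  refine ext_of_forall_mem_subalgebra_integral_eq_of_polish (separatesPoints_trigPoly (G := G)) ?_
  intro f hf
  have hf' : f ∈ Submodule.span ℂ (Set.range (evalBCF (G := G))) := hf
  have hi : ∀ (ν : Measure (PontryaginDual G)) [IsFiniteMeasure ν] (f : PontryaginDual G →ᵇ ℂ),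
      Integrable f ν := fun ν _ f => f.integrable ν
  induction hf' using Submodule.span_induction with
  | mem x hx =>
    obtain ⟨g, rfl⟩ := hx
    exact h g
  | zero => simp
  | add x y hx' hy' hx hy =>
    simp only [BoundedContinuousFunction.coe_add, Pi.add_apply]
    rw [integral_add (hi _ _) (hi _ _), integral_add (hi _ _) (hi _ _), hx hx', hy hy']
  | smul c x hx' hx =>
    simp only [BoundedContinuousFunction.coe_smul]
    rw [integral_smul, integral_smul, hx hx']

/-- The measures `r⁺ μ` and `r⁻ μ` are finite with the same Fourier transform, hence equal, so `r⁺ =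
r⁻` almost everywhere. -/
theorem ae_eq_zero_of_forall_integral_smul_eval_eq_zero {μ : Measure (PontryaginDual G)}
    [IsFiniteMeasure μ] {r : PontryaginDual G → ℝ} (hr : Integrable r μ)
    (h : ∀ g : G, ∫ χ, r χ • ((χ g : Circle) : ℂ) ∂μ = 0) : r =ᵐ[μ] 0 := by
  have hfin : ∀ r : PontryaginDual G → ℝ, Integrable r μ →
      IsFiniteMeasure (μ.withDensity fun χ => ENNReal.ofReal (r χ)) := fun r hr =>
    isFiniteMeasure_withDensity_ofReal hr.2
  have := hfin r hr
  have := hfin _ hr.neg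
  have hm : ∀ r : PontryaginDual G → ℝ, Integrable r μ →
      AEMeasurable (fun χ => ENNReal.ofReal (r χ)) μ := fun r hr =>
    hr.aestronglyMeasurable.aemeasurable.ennreal_ofReal
  have hint : ∀ r : PontryaginDual G → ℝ, Integrable r μ → ∀ g : G,
      Integrable (fun χ => (ENNReal.ofReal (r χ)).toReal • ((χ g : Circle) : ℂ)) μ := by
    intro r hr g
    refine Integrable.mono hr (AEStronglyMeasurable.smul
      (hm r hr).ennreal_toReal.aestronglyMeasurable
      (measurable_coe_eval_const g).aestronglyMeasurable)
      (Filter.Eventually.of_forall fun χ => ?_)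
    rw [norm_smul, Circle.norm_coe, mul_one, ENNReal.toReal_ofReal', Real.norm_eq_abs,
      Real.norm_eq_abs]
    exact abs_max_le_max_abs_abs.trans (by simp)
  have key : (μ.withDensity fun χ => ENNReal.ofReal (r χ)) =
      μ.withDensity fun χ => ENNReal.ofReal ((-r) χ) := by
    refine measure_ext fun g => ?_
    rw [integral_withDensity_eq_integral_toReal_smul₀ (hm r hr) (by simp),
      integral_withDensity_eq_integral_toReal_smul₀ (hm _ hr.neg) (by simp), ← sub_eq_zero,
      ← integral_sub (hint r hr g) (hint _ hr.neg g), ← h g]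
    refine integral_congr_ae (Filter.Eventually.of_forall fun χ => ?_)
    simp only [← sub_smul, ENNReal.toReal_ofReal', Pi.neg_apply]
    congr 1
    rcases le_total (r χ) 0 with h0 | h0
    · rw [max_eq_right h0, max_eq_left (neg_nonneg.2 h0)]; ring
    · rw [max_eq_left h0, max_eq_right (neg_nonpos.2 h0)]; ring
  rw [withDensity_eq_iff (hm r hr) (hm _ hr.neg)
    ((lintegral_mono fun χ => Real.ofReal_le_enorm _).trans_lt hr.2).ne] at key
  filter_upwards [key] with χ hχ
  simp only [Pi.neg_apply] at hχ
  rcases lt_trichotomy (r χ) 0 with h0 | h0 | h0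
  · rw [ENNReal.ofReal_of_nonpos h0.le] at hχ
    have := ENNReal.ofReal_eq_zero.1 hχ.symm
    simp only [Pi.zero_apply]
    linarith
  · exact h0
  · rw [ENNReal.ofReal_of_nonpos (neg_nonpos.2 h0.le)] at hχ
    have := ENNReal.ofReal_eq_zero.1 hχ
    simp only [Pi.zero_apply]
    linarith

end PontryaginDual

/-! ### Unimodular functions as elements of `L²` -/

section CircleLp

variable {α : Type*} [MeasurableSpace α] (μ : Measure α) [IsFiniteMeasure μ]

theorem memLp_circle {φ : α → Circle} (hφ : Measurable fun a => (φ a : ℂ)) :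
    MemLp (fun a => ((φ a : Circle) : ℂ)) 2 μ :=
  MemLp.of_bound hφ.aestronglyMeasurable 1
    (Filter.Eventually.of_forall fun a => (Circle.norm_coe (φ a)).le)

/-- The element of `L²` defined by a unimodular function. -/
def circleLp (φ : α → Circle) (hφ : Measurable fun a => (φ a : ℂ)) : Lp ℂ 2 μ := (memLp_circle μ hφ).toLp _

theorem coeFn_circleLp {φ : α → Circle} (hφ : Measurable fun a => (φ a : ℂ)) :
    circleLp μ φ hφ =ᵐ[μ] fun a => ((φ a : Circle) : ℂ) := MemLp.coeFn_toLp _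

theorem inner_circleLp {φ ψ : α → Circle} (hφ : Measurable fun a => (φ a : ℂ)) (hψ : Measurable fun a => (ψ a : ℂ)) :
    inner ℂ (circleLp μ φ hφ) (circleLp μ ψ hψ) = ∫ a, (((φ a)⁻¹ * ψ a : Circle) : ℂ) ∂μ := by
  rw [L2.inner_def]
  refine integral_congr_ae ?_
  filter_upwards [coeFn_circleLp μ hφ, coeFn_circleLp μ hψ] with a h1 h2
  rw [h1, h2, RCLike.inner_apply, Circle.coe_mul, Circle.coe_inv_eq_conj, mul_comm]

/-- Evaluations of characters are total in `L²`. -/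
theorem PontryaginDual.topologicalClosure_span_circleLp {G : Type*} [CommGroup G]
    [TopologicalSpace G] [IsTopologicalGroup G] [LocallyCompactSpace G] [SecondCountableTopology G]
    (μ : Measure (PontryaginDual G)) [IsFiniteMeasure μ] :
    (Submodule.span ℂ (Set.range fun g : G =>
      circleLp μ (fun χ => χ g) (measurable_coe_eval_const g))).topologicalClosure = ⊤ := by
  rw [Submodule.topologicalClosure_eq_top_iff, Submodule.eq_bot_iff]
  intro f hf
  have hf2 : MemLp f 2 μ := Lp.memLp f
  have hfi : Integrable f μ := hf2.integrable (by norm_num)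
  have h1 : ∀ g : G, ∫ χ, ((χ g : Circle) : ℂ) * f χ ∂μ = 0 := by
    intro g
    have h := (Submodule.mem_orthogonal _ _).1 hf _ (Submodule.subset_span ⟨g⁻¹, rfl⟩)
    rw [L2.inner_def] at h
    rw [← h]
    refine integral_congr_ae ?_
    filter_upwards [coeFn_circleLp μ (measurable_coe_eval_const g⁻¹)] with χ h1
    rw [h1, RCLike.inner_apply, coe_inv_apply, mul_comm]
    simp
  have hint : ∀ g : G, Integrable (fun χ => ((χ g : Circle) : ℂ) * f χ) μ := fun g =>
    hfi.bdd_mul (measurable_coe_eval_const g).aestronglyMeasurable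
      (c := 1) (Filter.Eventually.of_forall fun χ => (Circle.norm_coe (χ g)).le)
  have hint' : ∀ g : G, Integrable (fun χ => ((χ g : Circle) : ℂ) * star (f χ)) μ := fun g =>
    ((LinearIsometryEquiv.integrable_comp_iff Complex.conjLIE).2 hfi).bdd_mul
      (measurable_coe_eval_const g).aestronglyMeasurable
      (c := 1) (Filter.Eventually.of_forall fun χ => (Circle.norm_coe (χ g)).le)
  -- Conjugating the relation at `g⁻¹` shows that the conjugate of `f` also has zero transform.
  -- Hence so do its real and imaginary parts, to which the real-valued lemma applies.
  have h2 : ∀ g : G, ∫ χ, ((χ g : Circle) : ℂ) * star (f χ) ∂μ = 0 := by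
    intro g
    have h := congrArg (starRingEnd ℂ) (h1 g⁻¹)
    rw [← integral_conj, map_zero] at h
    rw [← h]
    refine integral_congr_ae (Filter.Eventually.of_forall fun χ => ?_)
    exact ((starRingEnd ℂ).map_mul _ _).trans (by rw [coe_inv_apply]; simp) |>.symm
  have hre := ae_eq_zero_of_forall_integral_smul_eval_eq_zero hfi.re (fun g => by
    have h3 : ∀ χ, RCLike.re (f χ) • ((χ g : Circle) : ℂ) =
        (1 / 2 : ℂ) * (((χ g : Circle) : ℂ) * f χ + ((χ g : Circle) : ℂ) * star (f χ)) := by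
      intro χ
      have h4 : (f χ) + star (f χ) = 2 * ((f χ).re : ℂ) := by
        simpa using Complex.add_conj (f χ)
      rw [← mul_add, h4, Complex.real_smul]
      simp only [RCLike.re_to_complex]
      ring
    simp_rw [h3]
    rw [integral_const_mul, integral_add (hint g) (hint' g), h1, h2]
    simp)
  have him := ae_eq_zero_of_forall_integral_smul_eval_eq_zero hfi.im (fun g => by
    have h3 : ∀ χ, RCLike.im (f χ) • ((χ g : Circle) : ℂ) =
        (-Complex.I / 2 : ℂ) *
          (((χ g : Circle) : ℂ) * f χ - ((χ g : Circle) : ℂ) * star (f χ)) := by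
      intro χ
      have h4 : (f χ) - star (f χ) = 2 * ((f χ).im : ℂ) * Complex.I := by
        simpa using Complex.sub_conj (f χ)
      rw [← mul_sub, h4, Complex.real_smul]
      simp only [RCLike.im_to_complex]
      linear_combination ((f χ).im * ((χ g : Circle) : ℂ)) * Complex.I_mul_I
    simp_rw [h3]
    rw [integral_const_mul, integral_sub (hint g) (hint' g), h1, h2]
    simp)
  refine (Lp.eq_zero_iff_ae_eq_zero).2 ?_
  filter_upwards [hre, him] with χ ha hb
  exact Complex.ext ha hb

end CircleLp

/-! ### Continuous linear maps between `L²` spaces -/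

section Lp

variable {α : Type*} [MeasurableSpace α]

theorem MeasureTheory.MemLp.circle_mul {μ : Measure α} {θ : α → Circle}
    (hθ : Measurable fun a => (θ a : ℂ)) {f : α → ℂ} (hf : MemLp f 2 μ) :
    MemLp (fun a => (θ a : ℂ) * f a) 2 μ :=
  hf.of_le (hθ.aestronglyMeasurable.mul hf.1) (Filter.Eventually.of_forall fun a => by
    rw [norm_mul, Circle.norm_coe, one_mul])

/-- Multiplication by a unimodular function as an isometry of `L²`. -/
def circleMul (μ : Measure α) (θ : α → Circle) (hθ : Measurable fun a => (θ a : ℂ)) :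
    Lp ℂ 2 μ →ₗᵢ[ℂ] Lp ℂ 2 μ where
  toFun f := ((Lp.memLp f).circle_mul hθ).toLp _
  map_add' f g := by
    rw [← MemLp.toLp_add]
    refine MemLp.toLp_congr _ _ ?_
    filter_upwards [Lp.coeFn_add f g] with a ha
    rw [ha]
    simp only [Pi.add_apply, mul_add]
  map_smul' c f := by
    rw [RingHom.id_apply, ← MemLp.toLp_const_smul]
    refine MemLp.toLp_congr _ _ ?_
    filter_upwards [Lp.coeFn_smul c f] with a ha
    rw [ha]
    simp only [Pi.smul_apply, smul_eq_mul, mul_left_comm]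
  norm_map' f := by
    simp only [LinearMap.coe_mk, AddHom.coe_mk]
    rw [Lp.norm_toLp, Lp.norm_def]
    congr 1
    exact eLpNorm_congr_norm_ae (Filter.Eventually.of_forall fun a => by
      rw [norm_mul, Circle.norm_coe, one_mul])

theorem circleMul_circleLp (μ : Measure α) [IsFiniteMeasure μ] {θ φ : α → Circle}
    (hθ : Measurable fun a => (θ a : ℂ)) (hφ : Measurable fun a => (φ a : ℂ))
    (hθφ : Measurable fun a => ((θ a * φ a : Circle) : ℂ)) :
    circleMul μ θ hθ (circleLp μ φ hφ) = circleLp μ (fun a => θ a * φ a) hθφ := by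
  refine MemLp.toLp_congr ((Lp.memLp _).circle_mul hθ) (memLp_circle μ hθφ) ?_
  filter_upwards [coeFn_circleLp μ hφ] with a ha
  rw [ha, Circle.coe_mul]

/-- The identity as a continuous map from `L²(μ)` to `L²(ν)` when `ν ≤ μ`. -/
def lpOfMeasureLE {μ ν : Measure α} (h : ν ≤ μ) : Lp ℂ 2 μ →L[ℂ] Lp ℂ 2 ν :=
  LinearMap.mkContinuous
    { toFun := fun f => ((Lp.memLp f).mono_measure h).toLp _
      map_add' := fun f g => by
        rw [← MemLp.toLp_add]
        exact MemLp.toLp_congr _ _ (ae_mono h (Lp.coeFn_add f g))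
      map_smul' := fun c f => by
        rw [RingHom.id_apply, ← MemLp.toLp_const_smul]
        exact MemLp.toLp_congr _ _ (ae_mono h (Lp.coeFn_smul c f)) } 1 (fun f => by
    simp only [LinearMap.coe_mk, AddHom.coe_mk]
    rw [one_mul, Lp.norm_toLp, Lp.norm_def]
    exact ENNReal.toReal_mono (Lp.eLpNorm_ne_top f) (eLpNorm_mono_measure _ h))

theorem lpOfMeasureLE_circleLp {μ ν : Measure α} [IsFiniteMeasure μ] [IsFiniteMeasure ν]
    (h : ν ≤ μ) {φ : α → Circle} (hφ : Measurable fun a => (φ a : ℂ)) :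
    lpOfMeasureLE h (circleLp μ φ hφ) = circleLp ν φ hφ :=
  MemLp.toLp_congr ((Lp.memLp _).mono_measure h) (memLp_circle ν hφ)
    (ae_mono h (coeFn_circleLp μ hφ))

end Lp

/-- Two families with the same Gram matrix, the first of them total, are related by an isometry. -/
theorem exists_linearIsometry_of_gram {ι E F : Type*} [NormedAddCommGroup E] [InnerProductSpace ℂ E]
    [NormedAddCommGroup F] [InnerProductSpace ℂ F] [CompleteSpace F] {u : ι → E} {v : ι → F}
    (hu : (Submodule.span ℂ (Set.range u)).topologicalClosure = ⊤)
    (huv : ∀ i j, inner ℂ (u i) (u j) = inner ℂ (v i) (v j)) :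
    ∃ Φ : E →ₗᵢ[ℂ] F, ∀ i, Φ (u i) = v i := by
  -- Equal Gram matrices give equal norms of finite combinations, so `u i ↦ v i` is well defined and
  -- isometric on a dense subspace.
  have hnorm : ∀ a : ι →₀ ℂ,
      ‖Finsupp.linearCombination ℂ v a‖ = ‖Finsupp.linearCombination ℂ u a‖ := by
    intro a
    have h : inner ℂ (Finsupp.linearCombination ℂ v a) (Finsupp.linearCombination ℂ v a) =
        inner ℂ (Finsupp.linearCombination ℂ u a) (Finsupp.linearCombination ℂ u a) := by
      simp only [Finsupp.linearCombination_apply, Finsupp.sum, sum_inner, inner_sum,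
        inner_smul_left, inner_smul_right, huv]
    rw [inner_self_eq_norm_sq_to_K, inner_self_eq_norm_sq_to_K] at h
    have h' : ‖Finsupp.linearCombination ℂ v a‖ ^ 2 = ‖Finsupp.linearCombination ℂ u a‖ ^ 2 := by
      exact_mod_cast h
    exact (pow_left_inj₀ (norm_nonneg _) (norm_nonneg _) two_ne_zero).1 h'
  have hd : DenseRange (Finsupp.linearCombination ℂ u) := by
    rw [DenseRange, ← LinearMap.coe_range, Finsupp.range_linearCombination]
    exact (Submodule.dense_iff_topologicalClosure_eq_top).2 hu
  have hb : ∀ a : ι →₀ ℂ,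
      ‖Finsupp.linearCombination ℂ v a‖ ≤ 1 * ‖Finsupp.linearCombination ℂ u a‖ := fun a => by
    rw [one_mul, hnorm]
  have heq := fun a => LinearMap.extendOfNorm_eq hd ⟨1, hb⟩ a
  let T := LinearMap.extendOfNorm (Finsupp.linearCombination ℂ v) (Finsupp.linearCombination ℂ u)
  refine ⟨⟨T.toLinearMap, fun x => ?_⟩, fun i => ?_⟩
  · refine hd.induction_on (p := fun x => ‖T x‖ = ‖x‖) x
      (isClosed_eq (by fun_prop) (by fun_prop)) fun a => ?_
    rw [heq, hnorm]
  · have h := heq (Finsupp.single i 1)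
    simpa using h

/-! ### Spectral measures and cyclic subspaces. -/

namespace UnitaryRep

open PontryaginDual (measurable_coe_eval_const topologicalClosure_span_circleLp measure_ext)

variable {G : Type*} [CommGroup G] [TopologicalSpace G]
  {E : Type*} [NormedAddCommGroup E] [InnerProductSpace ℂ E] (V : UnitaryRep G E)

theorem toHom_mul_apply (g g' : G) (x : E) :
    V.toHom (g * g') x = V.toHom g (V.toHom g' x) := by
  rw [map_mul]; rfl

theorem toHom_one_apply (x : E) : V.toHom 1 x = x := by
  rw [map_one]; rfl

theorem toHom_inv_apply_self (g : G) (x : E) : V.toHom g⁻¹ (V.toHom g x) = x := by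
  rw [← toHom_mul_apply, inv_mul_cancel, toHom_one_apply]

theorem inner_toHom_toHom (g g' : G) (x y : E) :
    inner ℂ (V.toHom g x) (V.toHom g' y) = inner ℂ x (V.toHom (g⁻¹ * g') y) := by
  rw [← (V.toHom g⁻¹).inner_map_map, toHom_inv_apply_self, toHom_mul_apply]

theorem mem_cyclicSubspace (x : E) (g : G) : V.toHom g x ∈ V.cyclicSubspace x :=
  Submodule.le_topologicalClosure _ (Submodule.subset_span ⟨g, rfl⟩)

theorem toHom_mem_cyclicSubspace {x y : E} (hy : y ∈ V.cyclicSubspace x) (g : G) :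
    V.toHom g y ∈ V.cyclicSubspace x := by
  have h : Submodule.span ℂ (Set.range fun g : G => V.toHom g x) ≤
      (V.cyclicSubspace x).comap (V.toHom g).toLinearEquiv.toLinearMap := by
    rw [Submodule.span_le]
    rintro _ ⟨g', rfl⟩
    change V.toHom g (V.toHom g' x) ∈ V.cyclicSubspace x
    rw [← toHom_mul_apply]
    exact V.mem_cyclicSubspace x _
  refine Submodule.topologicalClosure_minimal _ h ?_ hy
  exact (Submodule.isClosed_topologicalClosure _).preimage (V.toHom g).continuous

theorem cyclicSubspace_le {x : E} {F : Submodule ℂ E} (hF : IsClosed (F : Set E))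
    (h : ∀ g, V.toHom g x ∈ F) : V.cyclicSubspace x ≤ F := by
  refine Submodule.topologicalClosure_minimal _ ?_ hF
  rw [Submodule.span_le]
  rintro _ ⟨g, rfl⟩
  exact h g

theorem cyclicSubspace_isOrtho {x y : E} (h : ∀ g g', inner ℂ (V.toHom g x) (V.toHom g' y) = 0) :
    V.cyclicSubspace x ⟂ V.cyclicSubspace y := by
  refine V.cyclicSubspace_le (Submodule.isClosed_orthogonal _) fun g => ?_
  rw [Submodule.mem_orthogonal]
  intro u hu
  have h' : V.cyclicSubspace y ≤ (ℂ ∙ V.toHom g x)ᗮ :=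
    V.cyclicSubspace_le (Submodule.isClosed_orthogonal _) fun g' => by
      rw [Submodule.mem_orthogonal_singleton_iff_inner_right]
      exact h g g'
  exact (Submodule.mem_orthogonal_singleton_iff_inner_left).1 (h' hu)

namespace IsSpectralMeasure

variable {V}

variable [IsTopologicalGroup G] [LocallyCompactSpace G] [SecondCountableTopology G]

theorem unique {x : E} {μ μ' : Measure (PontryaginDual G)} (h : V.IsSpectralMeasure x μ)
    (h' : V.IsSpectralMeasure x μ') : μ = μ' := by
  have := h.1
  have := h'.1
  exact measure_ext fun g => by rw [← h.2, ← h'.2]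

variable [CompleteSpace E]

/-- Both Gram matrices have entries `∫ χ(g⁻¹ g') dμ`. -/
theorem exists_isometry {x : E} {μ : Measure (PontryaginDual G)} [IsFiniteMeasure μ]
    (h : V.IsSpectralMeasure x μ) : ∃ Φ : Lp ℂ 2 μ →ₗᵢ[ℂ] E, ∀ g,
      Φ (circleLp μ (fun χ => χ g) (measurable_coe_eval_const g)) = V.toHom g x := by
  refine exists_linearIsometry_of_gram (topologicalClosure_span_circleLp μ) fun g g' => ?_
  rw [inner_circleLp, inner_toHom_toHom, h.2]
  simp only [map_mul, map_inv]

/-- The isometry of `L²(μ)` onto the cyclic subspace of `x` which maps the evaluation at `g`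
to `V_g x`, where `μ` is the spectral measure of `x`. -/
def isometry {x : E} {μ : Measure (PontryaginDual G)} [IsFiniteMeasure μ]
    (h : V.IsSpectralMeasure x μ) : Lp ℂ 2 μ →ₗᵢ[ℂ] E := h.exists_isometry.choose

theorem isometry_eval {x : E} {μ : Measure (PontryaginDual G)} [IsFiniteMeasure μ]
    (h : V.IsSpectralMeasure x μ) (g : G) :
    h.isometry (circleLp μ (fun χ => χ g) (measurable_coe_eval_const g)) = V.toHom g x :=
  h.exists_isometry.choose_spec g

theorem dense_span_eval (μ : Measure (PontryaginDual G)) [IsFiniteMeasure μ] :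
    Dense (Submodule.span ℂ (Set.range fun g : G =>
      circleLp μ (fun χ => χ g) (measurable_coe_eval_const g)) : Set (Lp ℂ 2 μ)) :=
  Submodule.dense_iff_topologicalClosure_eq_top.2 (topologicalClosure_span_circleLp μ)

/-- This is how identities between operators on `L²(μ)` are proved below: it suffices to check them
on evaluations of characters, where everything is explicit. -/
theorem _root_.PontryaginDual.clm_ext {μ : Measure (PontryaginDual G)} [IsFiniteMeasure μ]
    {F : Type*} [NormedAddCommGroup F] [NormedSpace ℂ F] {S T : Lp ℂ 2 μ →L[ℂ] F}
    (h : ∀ g : G, S (circleLp μ (fun χ => χ g) (measurable_coe_eval_const g)) =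
      T (circleLp μ (fun χ => χ g) (measurable_coe_eval_const g))) : S = T := by
  refine ContinuousLinearMap.ext_on (dense_span_eval μ) ?_
  rintro _ ⟨g, rfl⟩
  exact h g

theorem isometry_mem_cyclicSubspace {x : E} {μ : Measure (PontryaginDual G)} [IsFiniteMeasure μ]
    (h : V.IsSpectralMeasure x μ) (f : Lp ℂ 2 μ) : h.isometry f ∈ V.cyclicSubspace x := by
  have h' : Submodule.span ℂ (Set.range fun g : G =>
      circleLp μ (fun χ => χ g) (measurable_coe_eval_const g)) ≤
      (V.cyclicSubspace x).comap h.isometry.toLinearMap := by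
    rw [Submodule.span_le]
    rintro _ ⟨g, rfl⟩
    change h.isometry _ ∈ V.cyclicSubspace x
    rw [isometry_eval]
    exact V.mem_cyclicSubspace x g
  have h1 := Submodule.topologicalClosure_minimal _ h'
    ((Submodule.isClosed_topologicalClosure _).preimage h.isometry.continuous)
  rw [topologicalClosure_span_circleLp] at h1
  exact h1 (Submodule.mem_top (x := f))

theorem toHom_isometry {x : E} {μ : Measure (PontryaginDual G)} [IsFiniteMeasure μ]
    (h : V.IsSpectralMeasure x μ) (g : G) (f : Lp ℂ 2 μ) :
    V.toHom g (h.isometry f) =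
      h.isometry (circleMul μ (fun χ => χ g) (measurable_coe_eval_const g) f) := by
  have h' : ((V.toHom g).toLinearIsometry.comp h.isometry).toContinuousLinearMap =
      (h.isometry.comp
        (circleMul μ (fun χ => χ g) (measurable_coe_eval_const g))).toContinuousLinearMap := by
    refine PontryaginDual.clm_ext fun g' => ?_
    change V.toHom g (h.isometry _) = h.isometry (circleMul _ _ _ _)
    have hm : Measurable fun χ : PontryaginDual G => ((χ g * χ g' : Circle) : ℂ) := by
      simpa only [map_mul] using measurable_coe_eval_const (g * g')
    rw [isometry_eval, circleMul_circleLp μ _ _ hm, ← toHom_mul_apply, ← h.isometry_eval]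
    simp only [map_mul]
  exact DFunLike.congr_fun h' f

/-- The vector `φ(V) x` for a unimodular function `φ` has the same spectral measure as `x`. -/
theorem isometry_circleLp {x : E} {μ : Measure (PontryaginDual G)} [IsFiniteMeasure μ]
    (h : V.IsSpectralMeasure x μ) {φ : PontryaginDual G → Circle}
    (hφ : Measurable fun χ => (φ χ : ℂ)) :
    V.IsSpectralMeasure (h.isometry (circleLp μ φ hφ)) μ := by
  refine ⟨inferInstance, fun g => ?_⟩
  have hm : Measurable fun χ : PontryaginDual G => ((χ g * φ χ : Circle) : ℂ) := by
    simpa only [Circle.coe_mul] using! (measurable_coe_eval_const g).mul hφ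
  rw [toHom_isometry, h.isometry.inner_map_map, circleMul_circleLp μ _ _ hm, inner_circleLp]
  congr 1
  ext χ
  congr 1
  rw [mul_comm, mul_assoc, mul_inv_cancel, mul_one]

end IsSpectralMeasure

/-! ### Functional calculus -/

variable [IsTopologicalGroup G] [LocallyCompactSpace G] [SecondCountableTopology G]
  [CompleteSpace E]

section Calculus

variable {V} (hV : ∀ x : E, ∃ μ, V.IsSpectralMeasure x μ)

include hV in
-- The operator is defined vector by vector, each through the isometry of its own spectral measure.
-- Linearity is the point at issue, as the measure changes with the vector.
theorem exists_calculus (φ : PontryaginDual G → Circle) (hφ : Measurable fun χ => (φ χ : ℂ)) :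
    ∃ T : E →ₗᵢ[ℂ] E, ∀ (x : E) (μ : Measure (PontryaginDual G)) [IsFiniteMeasure μ]
      (h : V.IsSpectralMeasure x μ), T x = h.isometry (circleLp μ φ hφ) := by
  have key : ∀ (x y z : E) (c : ℂ) (_ : z = c • x + y) (μ₁ μ₂ μ₃ : Measure (PontryaginDual G))
      [IsFiniteMeasure μ₁] [IsFiniteMeasure μ₂] [IsFiniteMeasure μ₃]
      (h₁ : V.IsSpectralMeasure x μ₁) (h₂ : V.IsSpectralMeasure y μ₂)
      (h₃ : V.IsSpectralMeasure z μ₃),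
      h₃.isometry (circleLp μ₃ φ hφ) =
        c • h₁.isometry (circleLp μ₁ φ hφ) + h₂.isometry (circleLp μ₂ φ hφ) := by
    intro x y z c hz μ₁ μ₂ μ₃ _ _ _ h₁ h₂ h₃
    -- The sum dominates all three measures, so both sides become continuous linear maps on a single
    -- `L²` space. They agree on evaluations because `V_g` is linear, hence also at `φ`.
    have le₁ : μ₁ ≤ μ₁ + μ₂ + μ₃ := Measure.le_add_right (Measure.le_add_right le_rfl)
    have le₂ : μ₂ ≤ μ₁ + μ₂ + μ₃ := Measure.le_add_right (Measure.le_add_left le_rfl)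
    have le₃ : μ₃ ≤ μ₁ + μ₂ + μ₃ := Measure.le_add_left le_rfl
    have h : h₃.isometry.toContinuousLinearMap.comp (lpOfMeasureLE le₃) =
        c • h₁.isometry.toContinuousLinearMap.comp (lpOfMeasureLE le₁) +
          h₂.isometry.toContinuousLinearMap.comp (lpOfMeasureLE le₂) := by
      refine PontryaginDual.clm_ext fun g => ?_
      simp only [ContinuousLinearMap.comp_apply, add_apply,
        smul_apply, LinearIsometry.coe_toContinuousLinearMap,
        lpOfMeasureLE_circleLp, IsSpectralMeasure.isometry_eval]
      rw [hz, map_add, map_smul]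
    have h' := DFunLike.congr_fun h (circleLp _ φ hφ)
    simpa only [ContinuousLinearMap.comp_apply, add_apply,
        smul_apply, LinearIsometry.coe_toContinuousLinearMap,
        lpOfMeasureLE_circleLp] using h'
  choose m hm using hV
  have hfin : ∀ x, IsFiniteMeasure (m x) := fun x => (hm x).1
  have hadd : ∀ x y, (hm (x + y)).isometry (circleLp (m (x + y)) φ hφ) =
      (hm x).isometry (circleLp (m x) φ hφ) + (hm y).isometry (circleLp (m y) φ hφ) := by
    intro x y
    rw [key x y (x + y) 1 (by rw [one_smul]) _ _ _ (hm x) (hm y) (hm _), one_smul]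
  refine ⟨⟨⟨⟨fun x => (hm x).isometry (circleLp (m x) φ hφ), hadd⟩, fun c x => ?_⟩, fun x => ?_⟩,
    fun x μ _ h => ?_⟩
  · have h0 : (hm 0).isometry (circleLp (m 0) φ hφ) = 0 := by
      have h := key 0 0 0 1 (by simp) _ _ _ (hm 0) (hm 0) (hm 0)
      rw [one_smul] at h
      exact left_eq_add.1 h
    have h' := key x 0 (c • x) c (by simp) _ _ _ (hm x) (hm 0) (hm _)
    rw [h0, add_zero] at h'
    exact h'
  · simp only [LinearMap.coe_mk, AddHom.coe_mk, LinearIsometry.norm_map]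
    have h1 : ‖circleLp (m x) φ hφ‖ =
        ‖circleLp (m x) (fun χ => χ 1) (measurable_coe_eval_const 1)‖ := by
      simp only [circleLp, Lp.norm_toLp]
      congr 1
      exact eLpNorm_congr_norm_ae (Filter.Eventually.of_forall fun a => by
        rw [Circle.norm_coe, Circle.norm_coe])
    rw [h1, ← (hm x).isometry.norm_map, IsSpectralMeasure.isometry_eval,
      LinearIsometryEquiv.norm_map]
  · obtain rfl := h.unique (hm x)
    rfl

/-- The unitary operator `φ(V)`, for a unimodular function `φ` on the dual group. -/
def calculus (φ : PontryaginDual G → Circle) (hφ : Measurable fun χ => (φ χ : ℂ)) : E →ₗᵢ[ℂ] E :=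
  (exists_calculus hV φ hφ).choose

theorem calculus_apply {φ : PontryaginDual G → Circle} (hφ : Measurable fun χ => (φ χ : ℂ))
    {x : E} {μ : Measure (PontryaginDual G)} [IsFiniteMeasure μ] (h : V.IsSpectralMeasure x μ) :
    calculus hV φ hφ x = h.isometry (circleLp μ φ hφ) :=
  (exists_calculus hV φ hφ).choose_spec x μ h

theorem calculus_eval (g : G) (x : E) :
    calculus hV (fun χ => χ g) (measurable_coe_eval_const g) x = V.toHom g x := by
  obtain ⟨μ, h⟩ := hV x
  have := h.1
  rw [calculus_apply hV _ h, h.isometry_eval]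

theorem calculus_mem_cyclicSubspace {φ : PontryaginDual G → Circle}
    (hφ : Measurable fun χ => (φ χ : ℂ)) (x : E) : calculus hV φ hφ x ∈ V.cyclicSubspace x := by
  obtain ⟨μ, h⟩ := hV x
  have := h.1
  rw [calculus_apply hV _ h]
  exact h.isometry_mem_cyclicSubspace _

/-- The vector `ψ(V) x` has the same spectral measure as `x`, and its isometry is that of `x`
preceded by multiplication by `ψ`. -/
theorem calculus_mul {φ ψ : PontryaginDual G → Circle} (hφ : Measurable fun χ => (φ χ : ℂ))
    (hψ : Measurable fun χ => (ψ χ : ℂ)) (hφψ : Measurable fun χ => ((φ χ * ψ χ : Circle) : ℂ))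
    (x : E) :
    calculus hV (fun χ => φ χ * ψ χ) hφψ x = calculus hV φ hφ (calculus hV ψ hψ x) := by
  obtain ⟨μ, h⟩ := hV x
  have := h.1
  have h' := h.isometry_circleLp hψ
  rw [calculus_apply hV _ h, calculus_apply hV _ h, calculus_apply hV _ h']
  have hc : h'.isometry.toContinuousLinearMap =
      (h.isometry.comp (circleMul μ ψ hψ)).toContinuousLinearMap := by
    refine PontryaginDual.clm_ext fun g => ?_
    change h'.isometry _ = h.isometry (circleMul _ _ _ _)
    have hm : Measurable fun χ : PontryaginDual G => ((χ g * ψ χ : Circle) : ℂ) := by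
      simpa only [Circle.coe_mul] using! (measurable_coe_eval_const g).mul hψ
    have hm' : Measurable fun χ : PontryaginDual G => ((ψ χ * χ g : Circle) : ℂ) := by
      simpa only [mul_comm] using hm
    rw [h'.isometry_eval, h.toHom_isometry, circleMul_circleLp μ _ _ hm,
      circleMul_circleLp μ _ _ hm']
    simp only [mul_comm]
  have hc' := DFunLike.congr_fun hc (circleLp μ φ hφ)
  have hm' : Measurable fun χ : PontryaginDual G => ((ψ χ * φ χ : Circle) : ℂ) := by
    simpa only [mul_comm] using hφψ
  change h'.isometry _ = h.isometry (circleMul _ _ _ _) at hc'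
  rw [hc', circleMul_circleLp μ _ _ hm']
  simp only [mul_comm]

theorem inner_calculus {φ ψ : PontryaginDual G → Circle} (hφ : Measurable fun χ => (φ χ : ℂ))
    (hψ : Measurable fun χ => (ψ χ : ℂ)) {x : E} {μ : Measure (PontryaginDual G)}
    (h : V.IsSpectralMeasure x μ) :
    inner ℂ (calculus hV φ hφ x) (calculus hV ψ hψ x) =
      ∫ χ, (((φ χ)⁻¹ * ψ χ : Circle) : ℂ) ∂μ := by
  have := h.1
  rw [calculus_apply hV _ h, calculus_apply hV _ h, h.isometry.inner_map_map, inner_circleLp]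

end Calculus

/-! ### Transport of a representation along a Borel map of dual groups -/

section Transport

variable {G' : Type*} [CommGroup G'] [TopologicalSpace G'] {V}

theorem _root_.Measurable.coe_eval {α : Type*} [MeasurableSpace α] {t : α → PontryaginDual G'}
    (ht : Measurable t) (g : G') : Measurable fun a => ((t a g : Circle) : ℂ) :=
  (measurable_coe_eval_const g).comp ht

theorem calculus_transport_mul (hV : ∀ x : E, ∃ μ, V.IsSpectralMeasure x μ)
    {t : PontryaginDual G → PontryaginDual G'} (ht : Measurable t) (g g' : G') (x : E) :
    calculus hV (fun χ => t χ (g * g')) (ht.coe_eval _) x =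
      calculus hV (fun χ => t χ g) (ht.coe_eval _)
        (calculus hV (fun χ => t χ g') (ht.coe_eval _) x) := by
  have hm : Measurable fun χ => ((t χ g * t χ g' : Circle) : ℂ) := by
    simpa only [map_mul] using ht.coe_eval (g * g')
  rw [← calculus_mul hV _ _ hm]
  simp only [map_mul]

theorem calculus_transport_one (hV : ∀ x : E, ∃ μ, V.IsSpectralMeasure x μ)
    {t : PontryaginDual G → PontryaginDual G'} (ht : Measurable t) (x : E) :
    calculus hV (fun χ => t χ 1) (ht.coe_eval _) x = x := by
  have h := calculus_eval hV 1 x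
  rw [toHom_one_apply] at h
  rw [← h]
  congr 1
  simp only [map_one]

variable [SecondCountableTopology G'] [IsTopologicalGroup G']

/-- The representation of `G'` with operators `(χ ↦ t(χ)(g))(V)`, for a Borel map `t` from the dual
of `G` to the dual of `G'`. -/
def transport (hV : ∀ x : E, ∃ μ, V.IsSpectralMeasure x μ)
    (t : PontryaginDual G → PontryaginDual G') (ht : Measurable t) : UnitaryRep G' E where
  toHom :=
    { toFun := fun g =>
        { toLinearEquiv := LinearEquiv.ofLinearMap
            (calculus hV (fun χ => t χ g) (Measurable.coe_eval ht _)).toLinearMap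
            (calculus hV (fun χ => t χ g⁻¹) (Measurable.coe_eval ht _)).toLinearMap
            (by
              ext1 x
              change calculus _ _ _ (calculus _ _ _ x) = x
              rw [← calculus_transport_mul hV ht]
              simp only [mul_inv_cancel]
              exact calculus_transport_one hV ht x)
            (by
              ext1 x
              change calculus _ _ _ (calculus _ _ _ x) = x
              rw [← calculus_transport_mul hV ht]
              simp only [inv_mul_cancel]
              exact calculus_transport_one hV ht x)
          norm_map' := (calculus hV (fun χ => t χ g) (ht.coe_eval _)).norm_map }
      map_one' := by
        ext1 x
        exact calculus_transport_one hV ht x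
      map_mul' := fun g g' => by
        ext1 x
        exact calculus_transport_mul hV ht g g' x }
  continuous_orbit x := by
    change Continuous fun g => calculus hV (fun χ => t χ g) (ht.coe_eval _) x
    obtain ⟨μ, h⟩ := hV x
    have := h.1
    have hn : ∀ g, ‖calculus hV (fun χ => t χ g) (ht.coe_eval _) x‖ = ‖x‖ := fun g =>
      LinearIsometry.norm_map _ _
    rw [continuous_iff_continuousAt]
    intro g₀
    rw [ContinuousAt, tendsto_iff_norm_sub_tendsto_zero]
    -- This integral is the inner product of the translates of `x` by `g₀` and `g`, continuous by
    -- dominated convergence. As these translates have the norm of `x`, it determines their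
    -- distance.
    have hc : Continuous fun g : G' => ∫ χ, (((t χ g₀)⁻¹ * t χ g : Circle) : ℂ) ∂μ := by
      refine continuous_of_dominated (bound := fun _ => 1) (fun g => ?_) (fun g => ?_)
        (integrable_const _) (Filter.Eventually.of_forall fun χ => ?_)
      · have : Measurable fun χ => ((t χ (g₀⁻¹ * g) : Circle) : ℂ) := ht.coe_eval _
        simp only [map_mul, map_inv] at this
        exact this.aestronglyMeasurable
      · exact Filter.Eventually.of_forall fun χ => (Circle.norm_coe _).le
      · have : Continuous fun g => (t χ g₀)⁻¹ * t χ g := continuous_const.mul (map_continuous (t χ))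
        exact continuous_induced_dom.comp this
    have hs : ∀ g, ‖calculus hV (fun χ => t χ g) (ht.coe_eval _) x -
        calculus hV (fun χ => t χ g₀) (ht.coe_eval _) x‖ =
        √(2 * ‖x‖ ^ 2 - 2 * (∫ χ, (((t χ g₀)⁻¹ * t χ g : Circle) : ℂ) ∂μ).re) := by
      intro g
      rw [← inner_calculus hV (ht.coe_eval g₀) (ht.coe_eval g) h, norm_sub_rev,
        ← Real.sqrt_sq (norm_nonneg _), norm_sub_sq (𝕜 := ℂ), hn, hn]
      congr 1
      simp only [RCLike.re_to_complex]
      ring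
    simp_rw [hs]
    have hc' : Continuous fun g : G' =>
        √(2 * ‖x‖ ^ 2 - 2 * (∫ χ, (((t χ g₀)⁻¹ * t χ g : Circle) : ℂ) ∂μ).re) :=
      (continuous_const.sub (continuous_const.mul (Complex.continuous_re.comp hc))).sqrt
    have h0 := hc'.tendsto g₀
    rwa [← hs g₀, sub_self, norm_zero] at h0

theorem transport_apply (hV : ∀ x : E, ∃ μ, V.IsSpectralMeasure x μ)
    {t : PontryaginDual G → PontryaginDual G'} (ht : Measurable t) (g : G') (x : E) :
    (transport hV t ht).toHom g x = calculus hV (fun χ => t χ g) (ht.coe_eval _) x := rfl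

theorem transport_mem_cyclicSubspace (hV : ∀ x : E, ∃ μ, V.IsSpectralMeasure x μ)
    {t : PontryaginDual G → PontryaginDual G'} (ht : Measurable t) (g : G') (x : E) :
    (transport hV t ht).toHom g x ∈ V.cyclicSubspace x :=
  calculus_mem_cyclicSubspace hV _ x

theorem IsSpectralMeasure.transport (hV : ∀ x : E, ∃ μ, V.IsSpectralMeasure x μ)
    {t : PontryaginDual G → PontryaginDual G'} (ht : Measurable t) {x : E}
    {μ : Measure (PontryaginDual G)} (h : V.IsSpectralMeasure x μ) :
    (transport hV t ht).IsSpectralMeasure x (μ.map t) := by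
  have := h.1
  refine ⟨inferInstance, fun g => ?_⟩
  rw [integral_map ht.aemeasurable (measurable_coe_eval_const g).aestronglyMeasurable]
  have h1 := inner_calculus hV (ht.coe_eval 1) (ht.coe_eval g) h
  rw [calculus_transport_one hV ht] at h1
  rw [transport_apply, h1]
  refine integral_congr_ae (Filter.Eventually.of_forall fun χ => ?_)
  simp only [map_one, inv_one, one_mul]

theorem transport_toHom_of_eval_eq (hV : ∀ x : E, ∃ μ, V.IsSpectralMeasure x μ)
    {t : PontryaginDual G → PontryaginDual G'} (ht : Measurable t) {g : G} {g' : G'}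
    (h : ∀ χ, t χ g' = χ g) (x : E) : (transport hV t ht).toHom g' x = V.toHom g x := by
  rw [transport_apply, ← calculus_eval hV]
  simp only [h]

end Transport

end UnitaryRep

/-! ### Spectral measures of sums of vectors. -/

namespace UnitaryRep

variable {G : Type*} [CommGroup G] [TopologicalSpace G]
  {E : Type*} [NormedAddCommGroup E] [InnerProductSpace ℂ E] {V : UnitaryRep G E}

/-- If the spectral measures of `x` and `y` are concentrated on disjoint sets, then `x` belongs to
the cyclic subspace of `x + y`. -/
theorem mem_cyclicSubspace_add [IsTopologicalGroup G] [LocallyCompactSpace G]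
    [SecondCountableTopology G] [CompleteSpace E] {x y : E} {μ₁ μ₂ : Measure (PontryaginDual G)}
    (h₁ : V.IsSpectralMeasure x μ₁) (h₂ : V.IsSpectralMeasure y μ₂) {S : Set (PontryaginDual G)}
    (hS : MeasurableSet S) (hμ₁ : μ₁ Sᶜ = 0) (hμ₂ : μ₂ S = 0) :
    x ∈ V.cyclicSubspace (x + y) := by
  have := h₁.1
  have := h₂.1
  have le₁ : μ₁ ≤ μ₁ + μ₂ := Measure.le_add_right le_rfl
  have le₂ : μ₂ ≤ μ₁ + μ₂ := Measure.le_add_left le_rfl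
  -- This map sends the evaluation at `g` to `V_g (x + y)`, so its values lie in the cyclic subspace
  -- of `x + y`. The indicator of `S` is `1` for `μ₁` and `0` for `μ₂`, hence is sent to `x`.
  let Ψ : Lp ℂ 2 (μ₁ + μ₂) →L[ℂ] E :=
    h₁.isometry.toContinuousLinearMap.comp (lpOfMeasureLE le₁) +
      h₂.isometry.toContinuousLinearMap.comp (lpOfMeasureLE le₂)
  have hΨ : ∀ f, Ψ f = h₁.isometry (lpOfMeasureLE le₁ f) + h₂.isometry (lpOfMeasureLE le₂ f) :=
    fun f => rfl
  have hle : Submodule.span ℂ (Set.range fun g : G =>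
      circleLp (μ₁ + μ₂) (fun χ => χ g) (PontryaginDual.measurable_coe_eval_const g)) ≤
      (V.cyclicSubspace (x + y)).comap Ψ.toLinearMap := by
    rw [Submodule.span_le]
    rintro _ ⟨g, rfl⟩
    change Ψ _ ∈ V.cyclicSubspace (x + y)
    rw [hΨ, lpOfMeasureLE_circleLp, lpOfMeasureLE_circleLp, h₁.isometry_eval, h₂.isometry_eval,
      ← map_add]
    exact V.mem_cyclicSubspace _ g
  have h := Submodule.topologicalClosure_minimal _ hle
    ((Submodule.isClosed_topologicalClosure _).preimage Ψ.continuous)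
  rw [PontryaginDual.topologicalClosure_span_circleLp] at h
  let e : Lp ℂ 2 (μ₁ + μ₂) := indicatorConstLp 2 hS (measure_ne_top _ _) (1 : ℂ)
  have he : Ψ e ∈ V.cyclicSubspace (x + y) := h (Submodule.mem_top (x := e))
  have hce : e =ᵐ[μ₁ + μ₂] S.indicator fun _ => (1 : ℂ) := indicatorConstLp_coeFn
  have he₁ : lpOfMeasureLE le₁ e =
      circleLp μ₁ (fun χ => χ 1) (PontryaginDual.measurable_coe_eval_const 1) := by
    refine MemLp.toLp_congr ((Lp.memLp _).mono_measure le₁) 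
      (memLp_circle μ₁ (PontryaginDual.measurable_coe_eval_const 1)) ?_
    have hae : ∀ᵐ χ ∂μ₁, χ ∈ S := hμ₁
    filter_upwards [ae_mono le₁ hce, hae] with χ h1 h2
    rw [h1, Set.indicator_of_mem h2, map_one, Circle.coe_one]
  have he₂ : lpOfMeasureLE le₂ e = 0 := by
    rw [Lp.eq_zero_iff_ae_eq_zero]
    refine (MemLp.coeFn_toLp ((Lp.memLp _).mono_measure le₂)).trans ?_
    have hae : ∀ᵐ χ ∂μ₂, χ ∉ S := measure_eq_zero_iff_ae_notMem.1 hμ₂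
    filter_upwards [ae_mono le₂ hce, hae] with χ h1 h2
    rw [h1, Set.indicator_of_notMem h2, Pi.zero_apply]
  rwa [hΨ, he₁, he₂, h₁.isometry_eval, map_zero, add_zero, toHom_one_apply] at he

theorem IsSpectralMeasure.norm_sq {x : E} {μ : Measure (PontryaginDual G)}
    (h : V.IsSpectralMeasure x μ) : μ Set.univ = ENNReal.ofReal (‖x‖ ^ 2) := by
  have := h.1
  have h1 := h.2 1
  simp only [map_one, Circle.coe_one, integral_const, LinearIsometryEquiv.coe_one, id,
    inner_self_eq_norm_sq_to_K] at h1
  have h2 : ‖x‖ ^ 2 = μ.real Set.univ := by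
    simp only [Complex.real_smul, mul_one] at h1
    exact Complex.ofReal_injective (by push_cast; exact h1)
  rw [h2, measureReal_def, ENNReal.ofReal_toReal (measure_ne_top _ _)]

/-- The spectral measure of an orthogonal sum. -/
theorem IsSpectralMeasure.sum {ι : Type*} {x : ι → E} {y : E} (hy : HasSum x y)
    (horth : ∀ i j, i ≠ j → ∀ g : G, inner ℂ (x i) (V.toHom g (x j)) = 0)
    {μ : ι → Measure (PontryaginDual G)} (h : ∀ i, V.IsSpectralMeasure (x i) (μ i)) :
    V.IsSpectralMeasure y (Measure.sum μ) := by
  have hg : ∀ g i, inner ℂ y (V.toHom g (x i)) = inner ℂ (x i) (V.toHom g (x i)) := by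
    intro g i
    have h1 : HasSum (fun j => inner ℂ (V.toHom g (x i)) (x j)) (inner ℂ (V.toHom g (x i)) y) :=
      hy.mapL (innerSL ℂ (V.toHom g (x i)))
    have h2 := hasSum_single (f := fun j => inner ℂ (V.toHom g (x i)) (x j)) i
      (fun j hj => inner_eq_zero_symm.1 (horth j i hj g))
    rw [← inner_conj_symm, h1.unique h2, inner_conj_symm]
  have hs : ∀ g, HasSum (fun i => inner ℂ (x i) (V.toHom g (x i))) (inner ℂ y (V.toHom g y)) := by
    intro g
    have h1 : HasSum (fun i => V.toHom g (x i)) (V.toHom g y) :=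
      hy.mapL ((V.toHom g).toLinearIsometry.toContinuousLinearMap)
    have h2 : HasSum (fun j => inner ℂ y (V.toHom g (x j))) (inner ℂ y (V.toHom g y)) :=
      h1.mapL (innerSL ℂ y)
    simpa only [hg] using h2
  have hsn : Summable fun i => ‖x i‖ ^ 2 := by
    have h1 := (hs 1).summable
    simp only [map_one, LinearIsometryEquiv.coe_one, id, inner_self_eq_norm_sq_to_K] at h1
    exact_mod_cast h1
  -- The mass of `μ i` is `‖x i‖ ^ 2`, and these are summable by orthogonality.
  have hfin : IsFiniteMeasure (Measure.sum μ) := by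
    refine ⟨?_⟩
    rw [Measure.sum_apply _ MeasurableSet.univ]
    simp_rw [fun i => (h i).norm_sq]
    rw [← ENNReal.ofReal_tsum_of_nonneg (fun i => by positivity) hsn]
    exact ENNReal.ofReal_lt_top
  refine ⟨hfin, fun g => ?_⟩
  have h1 := hasSum_integral_measure (PontryaginDual.integrable_coe_eval (Measure.sum μ) g)
  refine (hs g).unique ?_
  simp_rw [fun i => (h i).2 g]
  exact h1

end UnitaryRep

/-! ### Joint eigenvectors of representations that are scalar on a cocompact subgroup. -/

/-- A commuting family of operators preserving a nonzero finite-dimensional subspace has a joint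
eigenvector in it. -/
theorem exists_joint_eigenvector {ι K : Type*} [AddCommGroup K] [Module ℂ K] (T : ι → K →ₗ[ℂ] K)
    (hT : ∀ i j x, T i (T j x) = T j (T i x)) (F : Submodule ℂ K) [FiniteDimensional ℂ F]
    (hF : F ≠ ⊥) (hinv : ∀ i, ∀ x ∈ F, T i x ∈ F) :
    ∃ v ∈ F, v ≠ 0 ∧ ∀ i, ∃ c : ℂ, T i v = c • v := by
  induction hn : Module.finrank ℂ F using Nat.strong_induction_on generalizing F with
  | _ n ih =>
    by_cases hsc : ∀ i, ∃ c : ℂ, ∀ x ∈ F, T i x = c • x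
    · obtain ⟨v, hv, hv0⟩ := Submodule.exists_mem_ne_zero_of_ne_bot hF
      exact ⟨v, hv, hv0, fun i => (hsc i).imp fun c hc => hc v hv⟩
    -- If some `T i` is not scalar on `F`, an eigenspace of its restriction is a nonzero proper
    -- subspace, invariant under the family by commutation; induction on the dimension applies.
    · push Not at hsc
      obtain ⟨i, hi⟩ := hsc
      have : Nontrivial F := Submodule.nontrivial_iff_ne_bot.2 hF
      obtain ⟨c, hc⟩ := Module.End.exists_eigenvalue ((T i).restrict (hinv i))
      obtain ⟨⟨w, hw⟩, hw1, hw0⟩ := hc.exists_hasEigenvector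
      rw [Module.End.mem_eigenspace_iff] at hw1
      have hw1' : T i w = c • w := congrArg Subtype.val hw1
      have hw0' : w ≠ 0 := fun h => hw0 (Subtype.ext h)
      let F' : Submodule ℂ K := F ⊓ LinearMap.ker (T i - c • LinearMap.id)
      have hmem : ∀ x, x ∈ F' ↔ x ∈ F ∧ T i x = c • x := fun x => by
        simp [F', sub_eq_zero]
      have hle : F' ≤ F := inf_le_left
      have hlt : F' < F := by
        refine lt_of_le_of_ne hle fun h => ?_
        obtain ⟨x, hx, hx'⟩ := hi c
        exact hx' ((hmem x).1 (h ▸ hx)).2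
      have : FiniteDimensional ℂ F' := Submodule.finiteDimensional_of_le hle
      obtain ⟨v, hv, h⟩ := ih _ (hn ▸ Submodule.finrank_lt_finrank_of_lt hlt) F'
        (fun h => hw0' ((Submodule.eq_bot_iff _).1 h w ((hmem w).2 ⟨hw, hw1'⟩)))
        (fun j x hx => by
          rw [hmem] at hx ⊢
          exact ⟨hinv j x hx.1, by rw [hT, hx.2, map_smul]⟩) rfl
      exact ⟨v, hle hv, h⟩

namespace UnitaryRep

open InnerProductSpace

variable {G : Type*} [CommGroup G] [TopologicalSpace G]
  {K : Type*} [NormedAddCommGroup K] [InnerProductSpace ℂ K] (W : UnitaryRep G K)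

theorem toHom_comm (a b : G) (x : K) : W.toHom a (W.toHom b x) = W.toHom b (W.toHom a x) := by
  rw [← toHom_mul_apply, mul_comm, toHom_mul_apply]

/-- A joint eigenvector of a unitary representation defines a character. -/
theorem exists_character {v : K} (hv : v ≠ 0) (h : ∀ g, ∃ c : ℂ, W.toHom g v = c • v) :
    ∃ θ : PontryaginDual G, ∀ g, W.toHom g v = ((θ g : Circle) : ℂ) • v := by
  choose c hc using h
  have hinj : ∀ a b : ℂ, a • v = b • v → a = b := fun a b hab => smul_left_injective ℂ hv hab
  have hn : ∀ g, ‖c g‖ = 1 := by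
    intro g
    have h1 := (W.toHom g).norm_map v
    rw [hc, norm_smul] at h1
    exact (mul_eq_right₀ (norm_ne_zero_iff.2 hv)).1 h1
  have h1 : c 1 = 1 := hinj _ _ (by rw [← hc, toHom_one_apply, one_smul])
  have hm : ∀ a b, c (a * b) = c a * c b := fun a b => hinj _ _ (by
    rw [← hc, toHom_mul_apply, hc b, map_smul, hc a, smul_smul, mul_comm])
  have hcont : Continuous c := by
    have h2 : c = fun g => (inner ℂ v v)⁻¹ * inner ℂ v (W.toHom g v) := by
      ext g
      rw [hc, inner_smul_right, mul_comm (c g), inv_mul_cancel_left₀ (inner_self_ne_zero.2 hv)]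
    rw [h2]
    exact continuous_const.mul (continuous_const.inner (W.continuous_orbit v))
  let u : G → Circle := fun g => ⟨c g, mem_sphere_zero_iff_norm.2 (hn g)⟩
  have hu : ∀ g, ((u g : Circle) : ℂ) = c g := fun g => rfl
  let θ : G →ₜ* Circle :=
    { toFun := u
      map_one' := Circle.ext (by rw [hu, h1, Circle.coe_one])
      map_mul' := fun a b => Circle.ext (by rw [Circle.coe_mul, hu, hu, hu, hm])
      continuous_toFun := Continuous.subtype_mk hcont _ }
  exact ⟨θ, fun g => hc g⟩

variable {H : Subgroup G} (χ : H → Circle)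
  (hW : ∀ (h : H) (x : K), W.toHom h x = ((χ h : Circle) : ℂ) • x)

/-- The rank one operator defined by `W_g f` depends only on the coset of `g`. -/
def orbitRankOne (f : K) (y : G ⧸ H) : K →L[ℂ] K :=
  rankOne ℂ (W.toHom y.out f) (W.toHom y.out f)

include hW in
-- Replacing `g` by `g h` multiplies `W_g f` by the unimodular scalar `χ(h)`, which cancels against
-- its conjugate in the rank one operator.
theorem orbitRankOne_mk (f : K) (g : G) :
    W.orbitRankOne f (g : G ⧸ H) = rankOne ℂ (W.toHom g f) (W.toHom g f) := by
  obtain ⟨h, hh⟩ := QuotientGroup.mk_out_eq_mul H g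
  rw [orbitRankOne, hh, toHom_mul_apply, hW]
  simp only [map_smul, map_smulₛₗ, smul_apply, smul_smul]
  have h1 : (starRingEnd ℂ) ((χ h : Circle) : ℂ) * ((χ h : Circle) : ℂ) = 1 := by
    rw [Complex.conj_mul', Circle.norm_coe]
    simp
  exact (congrArg (fun c : ℂ => c • _) h1).trans (one_smul _ _)

include hW in
theorem continuous_orbitRankOne (f : K) : Continuous (W.orbitRankOne (H := H) f) := by
  rw [(QuotientGroup.isQuotientMap_mk H).continuous_iff]
  have h : (W.orbitRankOne (H := H) f) ∘ (QuotientGroup.mk : G → G ⧸ H) =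
      fun g => rankOne ℂ (W.toHom g f) (W.toHom g f) := by
    ext1 g
    exact W.orbitRankOne_mk χ hW f g
  rw [h]
  have h1 := W.continuous_orbit f
  exact ((ContinuousLinearMap.smulRightL ℂ K K).continuous.comp
    ((innerSL ℂ).continuous.comp h1)).clm_apply h1

variable [IsTopologicalGroup G] [MeasurableSpace (G ⧸ H)] [BorelSpace (G ⧸ H)]
  [CompactSpace (G ⧸ H)]
  (ν : Measure (G ⧸ H)) [ν.IsHaarMeasure] [CompleteSpace K]

/-- The average of the rank one operators along an orbit. -/
def orbitAverage (f : K) : K →L[ℂ] K := ∫ y, W.orbitRankOne f y ∂ν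

include hW in
theorem integrable_orbitRankOne (f : K) : Integrable (W.orbitRankOne f) ν :=
  (W.continuous_orbitRankOne χ hW f).integrable_of_hasCompactSupport (HasCompactSupport.of_compactSpace _)

include hW in
theorem orbitAverage_apply (f x : K) :
    W.orbitAverage ν f x = ∫ y, W.orbitRankOne f y x ∂ν :=
  ContinuousLinearMap.integral_apply (W.integrable_orbitRankOne χ hW ν f) x

include hW in
theorem integrable_orbitRankOne_apply (f x : K) : Integrable (fun y => W.orbitRankOne f y x) ν :=
  (W.integrable_orbitRankOne χ hW ν f).apply_continuousLinearMap x

include hW in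
-- The compact operators form a closed subspace containing the rank one integrand, so the integral
-- can be computed inside it.
theorem isCompactOperator_orbitAverage (f : K) : IsCompactOperator (W.orbitAverage ν f) := by
  let S : Submodule ℂ (K →L[ℂ] K) := compactOperator (RingHom.id ℂ) K K
  have hS : IsClosed (S : Set (K →L[ℂ] K)) := isClosed_setOfPred_isCompactOperator
  have hmem : ∀ y, W.orbitRankOne (H := H) f y ∈ S := fun y =>
    (isCompactOperator_of_locallyCompactSpace_rng
      (ContinuousLinearMap.toSpanSingleton ℂ (W.toHom y.out f))).comp_clm
      (innerSL ℂ (W.toHom y.out f))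
  have : CompleteSpace S := hS.completeSpace_coe
  have hc : Continuous fun y => (⟨W.orbitRankOne (H := H) f y, hmem y⟩ : S) :=
    (W.continuous_orbitRankOne χ hW f).subtype_mk _
  have hi : Integrable (fun y => (⟨W.orbitRankOne (H := H) f y, hmem y⟩ : S)) ν :=
    hc.integrable_of_hasCompactSupport (HasCompactSupport.of_compactSpace _)
  have h := S.subtypeL.integral_comp_comm hi
  have h' : W.orbitAverage ν f ∈ S := by
    rw [orbitAverage]
    exact h ▸ Subtype.mem _
  exact h'

include hW in
theorem isSymmetric_orbitAverage (f : K) : (W.orbitAverage ν f).IsSymmetric := by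
  intro x y
  change inner ℂ (W.orbitAverage ν f x) y = inner ℂ x (W.orbitAverage ν f y)
  rw [W.orbitAverage_apply χ hW, W.orbitAverage_apply χ hW,
    ← integral_inner (W.integrable_orbitRankOne_apply χ hW ν f y), ← inner_conj_symm,
    ← integral_inner (W.integrable_orbitRankOne_apply χ hW ν f x), ← integral_conj]
  refine integral_congr_ae (Filter.Eventually.of_forall fun z => ?_)
  simp only [inner_conj_symm]
  exact isSymmetric_rankOne_self (W.toHom z.out f) x y

include hW in
-- Conjugation by `W_a` translates the integrand by the coset of `a`, which leaves the integral
-- unchanged by invariance of `ν`.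
theorem toHom_orbitAverage (f : K) (a : G) (x : K) :
    W.toHom a (W.orbitAverage ν f x) = W.orbitAverage ν f (W.toHom a x) := by
  rw [W.orbitAverage_apply χ hW, W.orbitAverage_apply χ hW,
    ← integral_mul_left_eq_self (fun y => W.orbitRankOne f y (W.toHom a x)) (a : G ⧸ H)]
  have h := (W.toHom a).toLinearIsometry.toContinuousLinearMap.integral_comp_comm
    (W.integrable_orbitRankOne_apply χ hW ν f x)
  refine h.symm.trans (integral_congr_ae (Filter.Eventually.of_forall fun y => ?_))
  induction y using QuotientGroup.induction_on with
  | H g =>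
    change W.toHom a (W.orbitRankOne f (g : G ⧸ H) x) =
      W.orbitRankOne f (((a * g : G)) : G ⧸ H) (W.toHom a x)
    rw [W.orbitRankOne_mk χ hW, W.orbitRankOne_mk χ hW, rankOne_apply, rankOne_apply, map_smul,
      toHom_mul_apply, LinearIsometryEquiv.inner_map_map]

include hW in
-- The diagonal coefficient at `f` is the integral of `|⟨W_y f, f⟩|²`, a continuous nonnegative
-- function that is nonzero at the identity coset.
theorem orbitAverage_ne_zero {f : K} (hf : f ≠ 0) : W.orbitAverage ν f ≠ 0 := by
  intro h0
  have h1 : inner ℂ f (W.orbitAverage ν f f) = ∫ y, inner ℂ f (W.orbitRankOne f y f) ∂ν := by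
    rw [W.orbitAverage_apply χ hW, ← integral_inner (W.integrable_orbitRankOne_apply χ hW ν f f)]
  have h2 : ∀ y : G ⧸ H, inner ℂ f (W.orbitRankOne f y f) =
      ((‖inner ℂ (W.toHom y.out f) f‖ ^ 2 : ℝ) : ℂ) := by
    intro y
    rw [orbitRankOne, rankOne_apply, inner_smul_right, ← inner_conj_symm f, Complex.mul_conj']
    push_cast
    rfl
  have hc : Continuous fun y : G ⧸ H => ‖inner ℂ (W.toHom y.out f) f‖ ^ 2 := by
    have h3 : Continuous fun y : G ⧸ H => (inner ℂ f (W.orbitRankOne f y f) : ℂ).re := by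
      have := W.continuous_orbitRankOne χ hW f
      fun_prop
    simpa only [h2, Complex.ofReal_re] using h3
  have h4 : inner ℂ f (W.orbitRankOne f ((1 : G) : G ⧸ H) f) ≠ 0 := by
    rw [W.orbitRankOne_mk χ hW, toHom_one_apply, rankOne_apply, inner_smul_right]
    exact mul_ne_zero (inner_self_ne_zero.2 hf) (inner_self_ne_zero.2 hf)
  rw [h2] at h4
  have hpos : 0 < ∫ y : G ⧸ H, ‖inner ℂ (W.toHom y.out f) f‖ ^ 2 ∂ν :=
    hc.integral_pos_of_hasCompactSupport_nonneg_nonzero (HasCompactSupport.of_compactSpace _)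
      (fun y => by positivity) (fun h5 => h4 (by rw [h5]; simp))
  simp_rw [h2] at h1
  rw [h0, zero_apply, inner_zero_right] at h1
  exact hpos.ne (Complex.ofReal_injective (h1.trans integral_ofReal))

include χ hW ν in
/-- If a unitary representation is scalar on a closed cocompact subgroup, then its joint
eigenvectors are total. -/
theorem eq_zero_of_forall_joint_eigenvector {f : K}
    (hf : ∀ v : K, (∀ g, ∃ c : ℂ, W.toHom g v = c • v) → inner ℂ v f = 0) : f = 0 := by
  by_contra hf0
  have hR := W.orbitAverage_ne_zero χ hW ν hf0
  have hRc := W.isCompactOperator_orbitAverage χ hW ν f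
  have hRs := W.isSymmetric_orbitAverage χ hW ν f
  -- A nonzero compact symmetric operator has a nonzero eigenvalue. Its eigenspace is
  -- finite-dimensional and `W`-invariant, so it contains a joint eigenvector `v`.
  obtain ⟨c, hc, hc0⟩ : ∃ c, Module.End.HasEigenvalue
      (W.orbitAverage ν f : Module.End ℂ K) c ∧ c ≠ 0 := by
    by_contra! h
    exact hR ((ContinuousLinearMap.eq_zero_of_forall_hasEigenvalue_eq_zero hRc hRs).1 h)
  have := ContinuousLinearMap.finite_dimensional_eigenspace hRc c hc0
  obtain ⟨v, hv, hv0, hvc⟩ := exists_joint_eigenvector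
    (fun g => (W.toHom g).toLinearEquiv.toLinearMap) (fun a b x => W.toHom_comm a b x)
    (Module.End.eigenspace (W.orbitAverage ν f).toLinearMap c) hc (fun g x hx => by
      rw [Module.End.mem_eigenspace_iff] at hx ⊢
      change W.orbitAverage ν f (W.toHom g x) = c • W.toHom g x
      rw [← W.toHom_orbitAverage χ hW, ← map_smul, ← hx]
      rfl)
  rw [Module.End.mem_eigenspace_iff] at hv
  -- By assumption `v` is orthogonal to `f`, and being a joint eigenvector it is orthogonal to the
  -- whole orbit of `f`. The average therefore kills it, although its eigenvalue `c` is nonzero.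
  have h1 : W.orbitAverage ν f v = 0 := by
    rw [W.orbitAverage_apply χ hW]
    refine integral_eq_zero_of_ae (Filter.Eventually.of_forall fun y => ?_)
    obtain ⟨a, ha⟩ := hvc y.out⁻¹
    have h2 : inner ℂ (W.toHom y.out f) v = 0 := by
      rw [← (W.toHom y.out⁻¹).inner_map_map, toHom_inv_apply_self]
      have ha' : W.toHom y.out⁻¹ v = a • v := ha
      rw [ha', inner_smul_right, inner_eq_zero_symm.1 (hf v hvc), mul_zero]
    change rankOne ℂ _ _ v = 0
    rw [rankOne_apply, h2, zero_smul]
  have h2 : c • v = 0 := hv.symm.trans h1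
  exact hv0 ((smul_eq_zero.1 h2).resolve_left hc0)

end UnitaryRep

/-! ### Characters of `G` and induction from characters of `H`. -/

theorem dualRestriction_apply {G : Type*} [CommGroup G] [TopologicalSpace G] (H : Subgroup G)
    (χ : PontryaginDual G) (h : H) : dualRestriction H χ h = χ h := rfl

theorem dualRestriction_eq_one_iff {G : Type*} [CommGroup G] [TopologicalSpace G] {H : Subgroup G}
    {χ : PontryaginDual G} : dualRestriction H χ = 1 ↔ ∀ h : H, χ h = 1 :=
  ⟨fun hχ h => by rw [← dualRestriction_apply, hχ]; rfl, fun h => PontryaginDual.ext h⟩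

theorem Subgroup.coe_smul_quotient {G : Type*} [CommGroup G] {H : Subgroup G} (h : H)
    (y : G ⧸ H) : (h : G) • y = y := by
  induction y using QuotientGroup.induction_on with
  | H g =>
    rw [MulAction.Quotient.smul_coe, smul_eq_mul, mul_comm]
    exact QuotientGroup.mk_mul_of_mem g h.2

/-- A measurable function on a compact group which is almost invariant under every translation is
almost everywhere constant. -/
theorem exists_ae_eq_const_of_translation_invariant {Y : Type*} [CommGroup Y] [MeasurableSpace Y]
    [MeasurableMul₂ Y] [MeasurableInv Y] {ν : Measure Y} [SFinite ν] [ν.IsMulLeftInvariant]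
    {F : Y → ℂ} (hF : Measurable F) (h : ∀ b, ∀ᵐ a ∂ν, F (b * a) = F a) :
    ∃ c, ∀ᵐ y ∂ν, F y = c := by
  have h1 : ∀ᵐ b ∂ν, ∀ᵐ a ∂ν, F (b * a) = F a := Filter.Eventually.of_forall h
  -- Fubini exchanges the quantifiers: some fixed `a` satisfies `F (b * a) = F a` for almost every
  -- `b`.
  rw [Measure.ae_ae_comm] at h1
  · rcases eq_or_ne ν 0 with rfl | hν
    · exact ⟨0, by simp⟩
    · have : (ae ν).NeBot := ae_neBot.2 hν
      obtain ⟨a, ha⟩ := h1.exists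
      refine ⟨F a, ?_⟩
      filter_upwards [(quasiMeasurePreserving_mul_right ν a⁻¹).ae ha] with y hy
      simpa using hy
  · exact measurableSet_eq_fun (hF.comp (measurable_fst.mul measurable_snd))
      (hF.comp measurable_snd)

namespace UnitaryRep

section OneDim

variable {H : Type*} [CommGroup H] [TopologicalSpace H]

/-- The one-dimensional representation defined by a character. -/
def ofCharacter (χ : PontryaginDual H) : UnitaryRep H ℂ where
  toHom :=
    { toFun := fun h =>
        { toLinearEquiv := LinearEquiv.ofLinearMap
            (((χ h : Circle) : ℂ) • LinearMap.id) (((χ h⁻¹ : Circle) : ℂ) • LinearMap.id)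
            (by
              ext
              simp only [LinearMap.comp_apply, LinearMap.smul_apply, LinearMap.id_apply,
                smul_eq_mul, mul_one]
              rw [← Circle.coe_mul, ← map_mul, mul_inv_cancel, map_one, Circle.coe_one])
            (by
              ext
              simp only [LinearMap.comp_apply, LinearMap.smul_apply, LinearMap.id_apply,
                smul_eq_mul, mul_one]
              rw [← Circle.coe_mul, ← map_mul, inv_mul_cancel, map_one, Circle.coe_one])
          norm_map' := fun z => by
            change ‖((χ h : Circle) : ℂ) • z‖ = ‖z‖
            rw [norm_smul, Circle.norm_coe, one_mul] }
      map_one' := by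
        ext1 z
        change ((χ 1 : Circle) : ℂ) • z = z
        rw [map_one, Circle.coe_one, one_smul]
      map_mul' := fun a b => by
        ext1 z
        change ((χ (a * b) : Circle) : ℂ) • z = ((χ a : Circle) : ℂ) • ((χ b : Circle) : ℂ) • z
        rw [map_mul, Circle.coe_mul, mul_smul] }
  continuous_orbit z := by
    change Continuous fun h => ((χ h : Circle) : ℂ) • z
    exact (continuous_induced_dom.comp (map_continuous χ)).smul continuous_const

theorem ofCharacter_apply (χ : PontryaginDual H) (h : H) (z : ℂ) :
    (ofCharacter χ).toHom h z = ((χ h : Circle) : ℂ) • z := rfl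

end OneDim

section Induced

variable {G : Type*} [CommGroup G] [TopologicalSpace G] [MeasurableSpace G] {H : Subgroup G}
  (s : BorelCrossSection H)

omit [TopologicalSpace G] in
theorem _root_.BorelCrossSection.cocycle_coe (h : H) (y : G ⧸ H) : s.cocycle h y = h := by
  ext
  simp only [BorelCrossSection.cocycle, Subgroup.coe_smul_quotient]
  rw [mul_assoc, mul_comm (h : G), inv_mul_cancel_left]

/-- The cocycle takes values in `H`, where `χ` is trivial. Thus `y ↦ χ(s(y))` is the character of `G
⧸ H` induced by `χ`, up to the constant `χ(s(H)) = 1`. -/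
theorem _root_.BorelCrossSection.character_smul {χ : PontryaginDual G}
    (hχ : dualRestriction H χ = 1) (g : G) (y : G ⧸ H) :
    χ (s.toFun (g • y)) = χ g * χ (s.toFun y) := by
  have h := dualRestriction_eq_one_iff.1 hχ (s.cocycle g y)
  simp only [BorelCrossSection.cocycle, map_mul, map_inv] at h
  rw [mul_assoc, inv_mul_eq_one] at h
  exact h

variable {E : Type*} [NormedAddCommGroup E] [InnerProductSpace ℂ E]

/-- An element of `H` acts trivially on `G ⧸ H`, and by commutativity the cocycle at `h` is
constantly `h`. -/
theorem inducedFun_coe (V : UnitaryRep H E) (h : H) (f : G ⧸ H → E) (y : G ⧸ H) :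
    inducedFun s V h f y = V.toHom h (f y) := by
  have h1 : ((h : G))⁻¹ = ((h⁻¹ : H) : G) := rfl
  rw [inducedFun, h1, s.cocycle_coe, Subgroup.coe_smul_quotient, inv_inv]

variable [IsTopologicalGroup G] [LocallyCompactSpace G] [SecondCountableTopology G] [T2Space G]
  [BorelSpace G] [IsClosed (H : Set G)] [CompactSpace (G ⧸ H)]
  (ν : Measure (G ⧸ H)) [ν.IsHaarMeasure] [TopologicalSpace.SeparableSpace E]

theorem coeFn_induced (V : UnitaryRep H E) (g : G) (f : Lp E 2 ν) :
    (induced ν s V).toHom g f =ᵐ[ν] inducedFun s V g f :=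
  coeFn_inducedIsometry ν s V g f

theorem coeFn_induced_coe (V : UnitaryRep H E) (h : H) (f : Lp E 2 ν) :
    (induced ν s V).toHom h f =ᵐ[ν] fun y => V.toHom h (f y) :=
  (coeFn_induced s ν V h f).trans (Filter.Eventually.of_forall fun y => inducedFun_coe s V h f y)

theorem induced_ofCharacter_coe (χ : PontryaginDual H) (h : H) (f : Lp ℂ 2 ν) :
    (induced ν s (ofCharacter χ)).toHom h f = ((χ h : Circle) : ℂ) • f := by
  refine Lp.ext ((coeFn_induced_coe s ν _ h f).trans ?_)
  filter_upwards [Lp.coeFn_smul ((χ h : Circle) : ℂ) f] with y hy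
  rw [hy]
  rfl

include s ν in
/-- Characters of a closed cocompact subgroup extend to the whole group. -/
theorem _root_.dualRestriction_surjective : Function.Surjective (dualRestriction H) := by
  intro χ
  have : BorelSpace (G ⧸ H) := borelSpace_quotient
  -- On `H` this representation is the scalar `χ`, so it has a joint eigenvector, and the character
  -- of `G` by which it transforms restricts to `χ`.
  let W := induced ν s (ofCharacter χ)
  have hW : ∀ (h : H) (f : Lp ℂ 2 ν), W.toHom h f = ((χ h : Circle) : ℂ) • f :=
    induced_ofCharacter_coe s ν χ
  have hne : (indicatorConstLp 2 MeasurableSet.univ (measure_ne_top ν _) (1 : ℂ)) ≠ 0 := by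
    rw [← norm_ne_zero_iff, norm_indicatorConstLp (by simp) (by simp)]
    have : ν.real Set.univ ≠ 0 := by
      rw [measureReal_def]
      exact ENNReal.toReal_ne_zero.2
        ⟨(isOpen_univ.measure_pos ν Set.univ_nonempty).ne', measure_ne_top _ _⟩
    have : 0 < ν.real Set.univ := lt_of_le_of_ne measureReal_nonneg this.symm
    exact mul_ne_zero (by simp) (Real.rpow_pos_of_pos this _).ne'
  obtain ⟨v, hv, hv0⟩ : ∃ v : Lp ℂ 2 ν, (∀ g, ∃ c : ℂ, W.toHom g v = c • v) ∧ v ≠ 0 := by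
    by_contra! h
    exact hne (W.eq_zero_of_forall_joint_eigenvector χ hW ν fun v hv => by
      rw [h v hv, inner_zero_left])
  obtain ⟨θ, hθ⟩ := W.exists_character hv0 hv
  refine ⟨θ, PontryaginDual.ext fun h => Circle.ext (smul_left_injective ℂ hv0 ?_)⟩
  change ((θ h : Circle) : ℂ) • v = ((χ h : Circle) : ℂ) • v
  rw [← hθ, hW]

/-- The characters which are trivial on a closed cocompact subgroup `H` are total
in `L²(G ⧸ H)`. -/
theorem eq_zero_of_forall_integral_character_eq_zero {q : Lp ℂ 2 ν}
    (hq : ∀ θ : PontryaginDual G, dualRestriction H θ = 1 →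
      ∫ y, ((θ (s.toFun y) : Circle) : ℂ) * q y ∂ν = 0) : q = 0 := by
  have : BorelSpace (G ⧸ H) := borelSpace_quotient
  -- Inducing the trivial character gives the translations of `L²(G ⧸ H)`. Their joint eigenvectors
  -- are total, so it suffices to identify these with multiples of characters trivial on `H`.
  let W := induced ν s (ofCharacter (1 : PontryaginDual H))
  refine W.eq_zero_of_forall_joint_eigenvector (H := H) _
    (induced_ofCharacter_coe s ν 1) ν fun v hv => ?_
  rcases eq_or_ne v 0 with rfl | hv0
  · rw [inner_zero_left]
  obtain ⟨θ, hθ⟩ := W.exists_character hv0 hv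
  have hθ1 : dualRestriction H θ = 1 := by
    refine dualRestriction_eq_one_iff.2 fun h => Circle.ext (smul_left_injective ℂ hv0 ?_)
    change ((θ h : Circle) : ℂ) • v = ((1 : Circle) : ℂ) • v
    rw [← hθ]
    exact induced_ofCharacter_coe s ν 1 h v
  have hmeas : Measurable fun y => ((θ (s.toFun y) : Circle) : ℂ) * v y :=
    ((continuous_induced_dom.comp (map_continuous θ)).measurable.comp s.measurable_toFun).mul
      (Lp.stronglyMeasurable v).measurable
  -- Under translation `v` and `θ ∘ s` acquire inverse factors. Their product is therefore constant,
  -- so `v` is a multiple of the conjugate of `θ ∘ s`.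
  obtain ⟨c, hc⟩ := exists_ae_eq_const_of_translation_invariant (ν := ν) hmeas (fun b => by
    induction b using QuotientGroup.induction_on with
    | H g =>
      have h1 := coeFn_induced s ν (ofCharacter (1 : PontryaginDual H)) g⁻¹ v
      have h2 : (induced ν s (ofCharacter (1 : PontryaginDual H))).toHom g⁻¹ v = _ := hθ g⁻¹
      rw [h2] at h1
      filter_upwards [h1, Lp.coeFn_smul ((θ g⁻¹ : Circle) : ℂ) v] with y hy hy'
      have h3 : ((g : G ⧸ H) * y) = g • y := by
        induction y using QuotientGroup.induction_on with
        | H a => rfl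
      rw [hy'] at hy
      have h4 : inducedFun s (ofCharacter (1 : PontryaginDual H)) g⁻¹ v y = v (g • y) := by
        rw [inducedFun, ofCharacter_apply, inv_inv]
        simp
      rw [h4] at hy
      rw [h3, ← hy, s.character_smul hθ1, Pi.smul_apply, smul_eq_mul, ← mul_assoc,
        ← Circle.coe_mul, map_inv, mul_comm (θ g), mul_inv_cancel_right])
  rw [L2.inner_def]
  have h5 : ∫ y, inner ℂ (v y) (q y) ∂ν =
      ∫ y, (starRingEnd ℂ) c * (((θ (s.toFun y) : Circle) : ℂ) * q y) ∂ν := by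
    refine integral_congr_ae ?_
    filter_upwards [hc] with y hy
    have h6 : v y = (starRingEnd ℂ) ((θ (s.toFun y) : Circle) : ℂ) * c := by
      rw [← hy, ← mul_assoc, Complex.conj_mul', Circle.norm_coe]
      simp
    rw [h6, RCLike.inner_apply]
    have h7 := (starRingEnd ℂ).map_mul ((starRingEnd ℂ) ((θ (s.toFun y) : Circle) : ℂ)) c
    rw [h7, Complex.conj_conj]
    ring
  rw [h5, integral_const_mul, hq θ hθ1, mul_zero]

end Induced

end UnitaryRep

/-! ### The annihilator of a cocompact subgroup and Borel sections -/

section Annihilator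

variable {G : Type*} [CommGroup G] [TopologicalSpace G] [IsTopologicalGroup G]
  [LocallyCompactSpace G] (H : Subgroup G) [CompactSpace (G ⧸ H)]

theorem exists_isCompact_image_quotient_eq_univ :
    ∃ C : Set G, IsCompact C ∧ ∀ g : G, ∃ c ∈ C, (c : G ⧸ H) = g := by
  choose C hC hCn using fun g : G => exists_compact_mem_nhds g
  have hcov : (Set.univ : Set (G ⧸ H)) ⊆
      ⋃ g : G, (QuotientGroup.mk : G → G ⧸ H) '' interior (C g) := by
    intro y _
    obtain ⟨g, rfl⟩ := QuotientGroup.mk_surjective y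
    exact Set.mem_iUnion.2 ⟨g, g, mem_interior_iff_mem_nhds.2 (hCn g), rfl⟩
  obtain ⟨F, hF⟩ := isCompact_univ.elim_finite_subcover _
    (fun g => QuotientGroup.isOpenMap_coe _ isOpen_interior) hcov
  refine ⟨⋃ g ∈ F, C g, F.isCompact_biUnion fun g _ => hC g, fun g => ?_⟩
  obtain ⟨i, hi, c, hc, hcg⟩ := Set.mem_iUnion₂.1 (hF (Set.mem_univ (g : G ⧸ H)))
  exact ⟨c, Set.mem_biUnion hi (interior_subset hc), hcg⟩

/-- Take the characters mapping a compact `C` with image `G ⧸ H` into the arc of half-width `π / 2`;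
this set is open for the compact-open topology. If such a character is trivial on `H`, all its
values lie in the arc, powers included, and only `1` has all its powers there. -/
theorem exists_isOpen_dualRestriction_eq_one :
    ∃ O : Set (PontryaginDual G), IsOpen O ∧ 1 ∈ O ∧
      ∀ χ ∈ O, dualRestriction H χ = 1 → χ = 1 := by
  obtain ⟨C, hC, hCs⟩ := exists_isCompact_image_quotient_eq_univ H
  refine ⟨{χ | Set.MapsTo χ C (Circle.centeredArc (Real.pi / 2))}, ?_, ?_, fun χ hχ h1 => ?_⟩
  · exact isOpen_induced (ContinuousMap.isOpen_setOfPred_mapsTo hC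
      (Circle.isOpen_centeredArc (Real.pi / 2)))
  · intro c _
    rw [PontryaginDual.one_apply, Circle.mem_centeredArc (by linarith [Real.pi_pos])]
    simp [Real.pi_pos]
  · refine PontryaginDual.ext fun a => ?_
    refine Circle.eq_one_of_forall_pow_mem_centeredArc_pi_div_two fun n _ => ?_
    obtain ⟨c, hc, hca⟩ := hCs (a ^ n)
    have h2 := dualRestriction_eq_one_iff.1 h1 ⟨c⁻¹ * a ^ n, QuotientGroup.eq.1 hca⟩
    rw [map_mul, map_inv, inv_mul_eq_one, map_pow] at h2
    rw [← h2]
    exact hχ hc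

variable [SecondCountableTopology G]

/-- Translates of the isolating neighbourhood of `1` make the annihilator discrete, and a discrete
second countable space is countable. -/
theorem countable_dualRestriction_eq_one :
    Countable {χ : PontryaginDual G // dualRestriction H χ = 1} := by
  obtain ⟨O, hO, hO1, h⟩ := exists_isOpen_dualRestriction_eq_one H
  have : DiscreteTopology {χ : PontryaginDual G // dualRestriction H χ = 1} := by
    refine discreteTopology_iff_forall_isOpen.2 fun S => ?_
    have hs : S = ⋃ χ ∈ S, (fun ψ : {χ : PontryaginDual G // dualRestriction H χ = 1} =>
        (χ : PontryaginDual G)⁻¹ * ψ) ⁻¹' O := by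
      ext ψ
      simp only [Set.mem_iUnion, Set.mem_preimage, exists_prop]
      refine ⟨fun hψ => ⟨ψ, hψ, by rwa [inv_mul_cancel]⟩, fun ⟨χ, hχ, hχψ⟩ => ?_⟩
      have h1 := h _ hχψ (by rw [map_mul, map_inv, χ.2, ψ.2, inv_one, mul_one])
      rw [inv_mul_eq_one] at h1
      rwa [← Subtype.ext h1]
    rw [hs]
    exact isOpen_biUnion fun χ _ =>
      hO.preimage (continuous_const.mul continuous_subtype_val)
  exact countable_of_Lindelof_of_discrete

/-- The restriction map of dual groups has a Borel section. -/
theorem exists_measurable_section_dualRestriction [IsClosed (H : Set G)] [T2Space G]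
    (hsurj : Function.Surjective (dualRestriction H)) :
    ∃ t : PontryaginDual H → PontryaginDual G, Measurable t ∧
      ∀ β, dualRestriction H (t β) = β := by
  have hcont : Continuous (dualRestriction H) := map_continuous _
  obtain ⟨O, hO, hO1, h⟩ := exists_isOpen_dualRestriction_eq_one H
  obtain ⟨P, hP, hPO⟩ : ∃ P ∈ 𝓝 (1 : PontryaginDual G), ∀ a ∈ P, ∀ b ∈ P, a / b ∈ O :=
    exists_nhds_split_inv (hO.mem_nhds hO1)
  obtain ⟨Q, hQP, hQ, hQ1⟩ := mem_nhds_iff.1 hP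
  let d := TopologicalSpace.denseSeq (PontryaginDual G)
  -- These translates of `Q` are open and cover the dual of `G`. Two points of one translate have
  -- their quotient in `O`, so they coincide if their restrictions to `H` do.
  let D : ℕ → Set (PontryaginDual G) := fun n => (fun a => (d n)⁻¹ * a) ⁻¹' Q
  have hD : ∀ n, IsOpen (D n) := fun n => hQ.preimage (continuous_const.mul continuous_id)
  have hDcov : ∀ a, ∃ n, a ∈ D n := by
    intro a
    obtain ⟨n, hn⟩ := (TopologicalSpace.denseRange_denseSeq (PontryaginDual G)).exists_mem_open
      (hQ.preimage ((continuous_inv (G := PontryaginDual G)).mul (continuous_const (y := a))))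
      ⟨a, by simpa using hQ1⟩
    exact ⟨n, hn⟩
  have hDinj : ∀ n, Set.InjOn (dualRestriction H) (D n) := by
    intro n a ha b hb hab
    have h1 := hPO _ (hQP ha) _ (hQP hb)
    rw [mul_div_mul_left_eq_div] at h1
    exact div_eq_one.1 (h _ h1 (by rw [map_div, hab, div_self']))
  have : LocallyCompactSpace H := (IsClosed.isClosedEmbedding_subtypeVal ‹_›).locallyCompactSpace
  -- Lusin–Souslin: an injective continuous image of a Borel set is Borel.
  have himg : ∀ n (S : Set (PontryaginDual G)), MeasurableSet S →
      MeasurableSet (dualRestriction H '' (D n ∩ S)) := fun n S hS =>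
    ((hD n).measurableSet.inter hS).image_of_continuousOn_injOn hcont.continuousOn
      ((hDinj n).mono Set.inter_subset_left)
  have hex : ∀ β, ∃ n, ∃ a ∈ D n, dualRestriction H a = β := by
    intro β
    obtain ⟨a, ha⟩ := hsurj β
    obtain ⟨n, hn⟩ := hDcov a
    exact ⟨n, a, hn, ha⟩
  classical
  -- The section picks the unique point of the fibre in the first `D n` that meets it.
  choose t htD ht using fun β => Nat.find_spec (hex β)
  refine ⟨t, fun S hS => ?_, ht⟩
  have hpre : t ⁻¹' S = ⋃ n, (dualRestriction H '' (D n ∩ S)) \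
      ⋃ m ∈ Finset.range n, dualRestriction H '' (D m ∩ Set.univ) := by
    ext β
    simp only [Set.mem_preimage, Set.mem_iUnion, Set.mem_sdiff, Set.mem_image, Set.inter_univ,
      Finset.mem_range, exists_prop, not_exists, not_and]
    constructor
    · intro hβ
      refine ⟨Nat.find (hex β), ⟨t β, ⟨htD β, hβ⟩, ht β⟩, fun m hm a ha hab => ?_⟩
      exact Nat.find_min (hex β) hm ⟨a, ha, hab⟩
    · rintro ⟨n, ⟨a, ⟨haD, haS⟩, rfl⟩, hn⟩
      have hfind : Nat.find (hex (dualRestriction H a)) = n := by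
        refine (Nat.find_eq_iff _).2 ⟨⟨a, haD, rfl⟩, fun m hm ⟨b, hb, hb'⟩ => hn m hm b hb hb'⟩
      have h1 : t (dualRestriction H a) = a := by
        refine hDinj n ?_ haD (ht _)
        rw [← hfind]
        exact htD _
      rwa [h1]
  rw [hpre]
  exact MeasurableSet.iUnion fun n => (himg n S hS).diff
    (Finset.measurableSet_biUnion _ fun m _ => himg m _ MeasurableSet.univ)

end Annihilator

/-! ### Orthogonal decomposition of the induced representation. -/

namespace UnitaryRep

section Embedding

variable {G : Type*} [CommGroup G] [TopologicalSpace G] [MeasurableSpace G] {H : Subgroup G}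
  (s : BorelCrossSection H)
  {E : Type*} [NormedAddCommGroup E] [InnerProductSpace ℂ E]
  (W : UnitaryRep G E)

/-- The function `y ↦ χ(s(y))⁻¹ W_{s(y)}⁻¹ x`. -/
def twistedOrbit (χ : PontryaginDual G) (x : E) (y : G ⧸ H) : E :=
  ((χ (s.toFun y)⁻¹ : Circle) : ℂ) • W.toHom (s.toFun y)⁻¹ x

theorem norm_twistedOrbit (χ : PontryaginDual G) (x : E) (y : G ⧸ H) :
    ‖twistedOrbit s W χ x y‖ = ‖x‖ := by
  rw [twistedOrbit, norm_smul, Circle.norm_coe, one_mul, LinearIsometryEquiv.norm_map]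

theorem inner_twistedOrbit (χ ψ : PontryaginDual G) (x z : E) (y : G ⧸ H) :
    inner ℂ (twistedOrbit s W χ x y) (twistedOrbit s W ψ z y) =
      (((χ * ψ⁻¹) (s.toFun y) : Circle) : ℂ) * inner ℂ x z := by
  rw [twistedOrbit, twistedOrbit, inner_smul_left, inner_smul_right,
    LinearIsometryEquiv.inner_map_map, ← mul_assoc]
  have h : (χ * ψ⁻¹) (s.toFun y) = (χ (s.toFun y)⁻¹)⁻¹ * ψ (s.toFun y)⁻¹ := by
    rw [map_inv, map_inv, inv_inv]; rfl
  rw [h, Circle.coe_mul, Circle.coe_inv_eq_conj]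

variable [IsTopologicalGroup G] [LocallyCompactSpace G] [SecondCountableTopology G] [T2Space G]
  [BorelSpace G]

theorem stronglyMeasurable_orbit_section (f : G ⧸ H → E) (hf : StronglyMeasurable f) :
    StronglyMeasurable fun y => W.toHom (s.toFun y) (f y) := by
  have := polishSpace_of_locallyCompact_group G
  exact W.continuous_uncurry.comp_stronglyMeasurable
    (s.measurable_toFun.stronglyMeasurable.prodMk hf)

theorem stronglyMeasurable_twistedOrbit (χ : PontryaginDual G) (x : E) :
    StronglyMeasurable (twistedOrbit s W χ x) := by
  have := polishSpace_of_locallyCompact_group G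
  have h : Continuous fun g : G => ((χ g⁻¹ : Circle) : ℂ) • W.toHom g⁻¹ x :=
    (continuous_induced_dom.comp ((map_continuous χ).comp continuous_inv)).smul
      ((W.continuous_orbit x).comp continuous_inv)
  exact h.comp_stronglyMeasurable s.measurable_toFun.stronglyMeasurable

variable [IsClosed (H : Set G)] [CompactSpace (G ⧸ H)] (ν : Measure (G ⧸ H)) [ν.IsHaarMeasure]

theorem memLp_twistedOrbit (χ : PontryaginDual G) (x : E) :
    MemLp (twistedOrbit s W χ x) 2 ν :=
  MemLp.of_bound (stronglyMeasurable_twistedOrbit s W χ x).aestronglyMeasurable ‖x‖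
    (Filter.Eventually.of_forall fun y => (norm_twistedOrbit s W χ x y).le)

/-- The linear map `x ↦ χ(s(·))⁻¹ W_{s(·)}⁻¹ x` to `L²`. -/
def twistedOrbitLp (χ : PontryaginDual G) : E →ₗ[ℂ] Lp E 2 ν where
  toFun x := (memLp_twistedOrbit s W ν χ x).toLp _
  map_add' x z := by
    rw [← MemLp.toLp_add]
    refine MemLp.toLp_congr _ _ (Filter.Eventually.of_forall fun y => ?_)
    simp only [twistedOrbit, map_add, smul_add, Pi.add_apply]
  map_smul' c x := by
    rw [RingHom.id_apply, ← MemLp.toLp_const_smul]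
    refine MemLp.toLp_congr _ _ (Filter.Eventually.of_forall fun y => ?_)
    simp only [twistedOrbit, map_smul, Pi.smul_apply]
    rw [smul_comm]

theorem coeFn_twistedOrbitLp (χ : PontryaginDual G) (x : E) :
    twistedOrbitLp s W ν χ x =ᵐ[ν] twistedOrbit s W χ x :=
  MemLp.coeFn_toLp (memLp_twistedOrbit s W ν χ x)

theorem inner_twistedOrbitLp (χ ψ : PontryaginDual G) (x z : E) :
    inner ℂ (twistedOrbitLp s W ν χ x) (twistedOrbitLp s W ν ψ z) =
      (∫ y, (((χ * ψ⁻¹) (s.toFun y) : Circle) : ℂ) ∂ν) * inner ℂ x z := by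
  rw [L2.inner_def, ← integral_mul_const]
  refine integral_congr_ae ?_
  filter_upwards [coeFn_twistedOrbitLp s W ν χ x, coeFn_twistedOrbitLp s W ν ψ z] with y h1 h2
  rw [h1, h2, inner_twistedOrbit]

/-- Translating by `g` with `θ(g) ≠ 1` multiplies the integral by `θ(g)` without changing it. -/
theorem integral_character_eq_zero {θ : PontryaginDual G} (hθ : dualRestriction H θ = 1)
    (hθ1 : θ ≠ 1) : ∫ y, ((θ (s.toFun y) : Circle) : ℂ) ∂ν = 0 := by
  have : BorelSpace (G ⧸ H) := borelSpace_quotient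
  obtain ⟨g, hg⟩ : ∃ g, θ g ≠ 1 := by
    by_contra! h
    exact hθ1 (PontryaginDual.ext h)
  have h1 := integral_mul_left_eq_self (μ := ν)
    (fun y => ((θ (s.toFun y) : Circle) : ℂ)) (g : G ⧸ H)
  have h2 : ∀ y : G ⧸ H, ((θ (s.toFun ((g : G ⧸ H) * y)) : Circle) : ℂ) =
      ((θ g : Circle) : ℂ) * ((θ (s.toFun y) : Circle) : ℂ) := by
    intro y
    have h3 : ((g : G ⧸ H) * y) = g • y := by
      induction y using QuotientGroup.induction_on with
      | H a => rfl
    rw [h3, s.character_smul hθ, Circle.coe_mul]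
  simp_rw [h2] at h1
  rw [integral_const_mul] at h1
  by_contra h0
  exact hg (Circle.ext ((mul_eq_right₀ h0).1 h1))

theorem measureReal_univ_pos : 0 < ν.real Set.univ := by
  have : BorelSpace (G ⧸ H) := borelSpace_quotient
  rw [measureReal_def]
  exact ENNReal.toReal_pos (isOpen_univ.measure_pos ν Set.univ_nonempty).ne' (measure_ne_top _ _)

/-- The normalized map `x ↦ ν(G ⧸ H)^{-1/2} χ(s(·))⁻¹ W_{s(·)}⁻¹ x`, as an isometry. -/
def embedding (χ : PontryaginDual G) : E →ₗᵢ[ℂ] Lp E 2 ν where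
  toLinearMap := (((√(ν.real Set.univ))⁻¹ : ℝ) : ℂ) • twistedOrbitLp s W ν χ
  norm_map' x := by
    have hpos := measureReal_univ_pos (H := H) ν
    have h1 := inner_twistedOrbitLp s W ν χ χ x x
    rw [mul_inv_cancel] at h1
    simp only [PontryaginDual.one_apply, Circle.coe_one, integral_const,
      inner_self_eq_norm_sq_to_K, Complex.real_smul, mul_one] at h1
    have h2 : ‖twistedOrbitLp s W ν χ x‖ ^ 2 = ν.real Set.univ * ‖x‖ ^ 2 :=
      Complex.ofReal_injective (by push_cast; exact h1)
    have h3 : ‖twistedOrbitLp s W ν χ x‖ = √(ν.real Set.univ) * ‖x‖ := by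
      rw [← Real.sqrt_sq (norm_nonneg (twistedOrbitLp s W ν χ x)), h2,
        Real.sqrt_mul hpos.le, Real.sqrt_sq (norm_nonneg x)]
    rw [LinearMap.smul_apply, norm_smul, h3, Complex.norm_real, norm_inv, Real.norm_eq_abs,
      abs_of_pos (Real.sqrt_pos.2 hpos), inv_mul_cancel_left₀ (Real.sqrt_pos.2 hpos).ne']

theorem embedding_apply (χ : PontryaginDual G) (x : E) :
    embedding s W ν χ x = (((√(ν.real Set.univ))⁻¹ : ℝ) : ℂ) • twistedOrbitLp s W ν χ x := rfl

theorem inner_embedding_of_ne {χ ψ : PontryaginDual G} (hχ : dualRestriction H χ = 1)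
    (hψ : dualRestriction H ψ = 1) (h : χ ≠ ψ) (x z : E) :
    inner ℂ (embedding s W ν χ x) (embedding s W ν ψ z) = 0 := by
  have h1 : dualRestriction H (χ * ψ⁻¹) = 1 := by rw [map_mul, map_inv, hχ, hψ, inv_one, mul_one]
  have h2 : χ * ψ⁻¹ ≠ 1 := fun h' => h (mul_inv_eq_one.1 h')
  rw [embedding_apply, embedding_apply, inner_smul_left, inner_smul_right, inner_twistedOrbitLp,
    integral_character_eq_zero s ν h1 h2]
  simp

variable [CompleteSpace E] [TopologicalSpace.SeparableSpace E]

/-- Orthogonality is that of distinct characters of `G ⧸ H`. For totality, if `F` is orthogonal to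
all images, then for each `x` the function `y ↦ ⟨x, W_{s(y)} F(y)⟩` is orthogonal to all these
characters and vanishes almost everywhere. Letting `x` run through a countable dense set gives `F =
0`. -/
theorem isHilbertSum_embedding :
    IsHilbertSum ℂ (fun _ : {χ : PontryaginDual G // dualRestriction H χ = 1} => E)
      (fun χ => embedding s W ν χ) := by
  refine IsHilbertSum.mk ?_ ?_
  · intro χ ψ h x z
    exact inner_embedding_of_ne s W ν χ.2 ψ.2 (fun h' => h (Subtype.ext h')) x z
  · rw [top_le_iff, Submodule.topologicalClosure_eq_top_iff, Submodule.eq_bot_iff]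
    intro F hF
    rw [Submodule.mem_orthogonal] at hF
    have hF1 : ∀ χ : PontryaginDual G, dualRestriction H χ = 1 → ∀ x : E,
        inner ℂ (twistedOrbitLp s W ν χ x) F = 0 := by
      intro χ hχ x
      have h1 := hF _ (Submodule.mem_iSup_of_mem
        (⟨χ, hχ⟩ : {χ : PontryaginDual G // dualRestriction H χ = 1})
        ⟨x, (rfl : _ = embedding s W ν χ x)⟩)
      rw [embedding_apply, inner_smul_left] at h1
      refine (mul_eq_zero.1 h1).resolve_left ?_
      have hpos := Real.sqrt_pos.2 (measureReal_univ_pos (H := H) ν)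
      simp [hpos.ne']
    have hFm := Lp.stronglyMeasurable F
    have hq : ∀ x : E, ∀ᵐ y ∂ν, inner ℂ x (W.toHom (s.toFun y) (F y)) = 0 := by
      intro x
      have hmem : MemLp (fun y => inner ℂ x (W.toHom (s.toFun y) (F y))) 2 ν := by
        refine ((Lp.memLp F).norm.const_mul ‖x‖).mono
          ((stronglyMeasurable_const.inner
            (stronglyMeasurable_orbit_section s W _ hFm)).aestronglyMeasurable)
          (Filter.Eventually.of_forall fun y => ?_)
        refine (norm_inner_le_norm _ _).trans ?_
        rw [LinearIsometryEquiv.norm_map, norm_mul, norm_norm, norm_norm]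
      have h0 : hmem.toLp _ = 0 := by
        refine eq_zero_of_forall_integral_character_eq_zero s ν fun θ hθ => ?_
        rw [← hF1 θ hθ x, L2.inner_def]
        refine integral_congr_ae ?_
        filter_upwards [hmem.coeFn_toLp, coeFn_twistedOrbitLp s W ν θ x] with y h1 h2
        rw [h1, h2, twistedOrbit, inner_smul_left, ← Circle.coe_inv_eq_conj, map_inv, inv_inv,
          ← (W.toHom (s.toFun y)⁻¹).inner_map_map x, toHom_inv_apply_self]
      filter_upwards [hmem.coeFn_toLp, (Lp.eq_zero_iff_ae_eq_zero).1 h0] with y h1 h2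
      rw [← h1, h2, Pi.zero_apply]
    have hall : ∀ᵐ y ∂ν, ∀ n : ℕ,
        inner ℂ (TopologicalSpace.denseSeq E n) (W.toHom (s.toFun y) (F y)) = 0 :=
      ae_all_iff.2 fun n => hq _
    rw [Lp.eq_zero_iff_ae_eq_zero]
    filter_upwards [hall] with y hy
    have h1 : ∀ x : E, inner ℂ x (W.toHom (s.toFun y) (F y)) = 0 := fun x =>
      (TopologicalSpace.denseRange_denseSeq E).induction_on
        (p := fun x => inner ℂ x (W.toHom (s.toFun y) (F y)) = 0) x
        (isClosed_eq (by fun_prop) continuous_const) hy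
    have h2 := inner_self_eq_zero.1 (h1 (W.toHom (s.toFun y) (F y)))
    exact (LinearIsometryEquiv.map_eq_zero_iff _).1 h2

/-- The identity `h(g⁻¹, y)⁻¹ s(g⁻¹y)⁻¹ = s(y)⁻¹ g` turns the cocycle into `W_g`, once `V` is read
as the restriction of `W`; the scalar `χ(g)` comes from `χ(s(g⁻¹y))⁻¹ = χ(g) χ(s(y))⁻¹`. -/
theorem induced_embedding (V : UnitaryRep H E) (hWV : ∀ (h : H) (x : E), W.toHom h x = V.toHom h x)
    {χ : PontryaginDual G} (hχ : dualRestriction H χ = 1) (g : G) (x : E) :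
    (induced ν s V).toHom g (embedding s W ν χ x) =
      ((χ g : Circle) : ℂ) • embedding s W ν χ (W.toHom g x) := by
  rw [embedding_apply, embedding_apply, map_smul, smul_comm]
  congr 1
  refine Lp.ext ((coeFn_induced s ν V g _).trans
    ((inducedFun_congr ν s V g (coeFn_twistedOrbitLp s W ν χ x)).trans ?_))
  filter_upwards [Lp.coeFn_smul ((χ g : Circle) : ℂ) (twistedOrbitLp s W ν χ (W.toHom g x)),
    coeFn_twistedOrbitLp s W ν χ (W.toHom g x)] with y h1 h2
  rw [h1, Pi.smul_apply, h2, inducedFun, twistedOrbit, twistedOrbit, map_smul, smul_smul,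
    ← hWV, ← toHom_mul_apply, ← toHom_mul_apply, ← Circle.coe_mul]
  have h3 := s.character_smul hχ g⁻¹ y
  have h4 : χ (s.toFun (g⁻¹ • y))⁻¹ = χ g * χ (s.toFun y)⁻¹ := by
    rw [map_inv, h3, map_inv, map_inv, mul_inv, inv_inv]
  rw [h4]
  congr 2
  simp only [BorelCrossSection.cocycle, Subgroup.coe_inv]
  congr 1
  group

end Embedding

end UnitaryRep

/-! ### Measure classes and weights. -/

theorem MeasureEquivalent.map {α β : Type*} [MeasurableSpace α] [MeasurableSpace β]
    {μ ν : Measure α} (h : MeasureEquivalent μ ν) {f : α → β} (hf : Measurable f) :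
    MeasureEquivalent (μ.map f) (ν.map f) := ⟨h.1.map hf, h.2.map hf⟩

theorem MeasureEquivalent.restrict {α : Type*} [MeasurableSpace α]
    {μ ν : Measure α} (h : MeasureEquivalent μ ν) (S : Set α) :
    MeasureEquivalent (μ.restrict S) (ν.restrict S) := ⟨h.1.restrict S, h.2.restrict S⟩

theorem MeasureTheory.Measure.AbsolutelyContinuous.sum {α ι : Type*} [MeasurableSpace α]
    {μ ν : ι → Measure α} (h : ∀ i, μ i ≪ ν i) : Measure.sum μ ≪ Measure.sum ν := by
  refine Measure.AbsolutelyContinuous.mk fun S hS hν => ?_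
  rw [Measure.sum_apply _ hS, ENNReal.tsum_eq_zero] at hν ⊢
  exact fun i => h i (hν i)

theorem MeasureEquivalent.sum {α ι : Type*} [MeasurableSpace α] {μ ν : ι → Measure α}
    (h : ∀ i, MeasureEquivalent (μ i) (ν i)) : MeasureEquivalent (Measure.sum μ) (Measure.sum ν) :=
  ⟨.sum fun i => (h i).1, .sum fun i => (h i).2⟩

theorem exists_pos_summable_sq (ι : Type*) [Countable ι] :
    ∃ w : ι → ℝ, (∀ i, 0 < w i) ∧ Summable fun i => w i ^ 2 := by
  have := Encodable.ofCountable ι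
  obtain ⟨u, hu, c, hc, -⟩ := posSumOfEncodable one_pos ι
  refine ⟨fun i => √(u i), fun i => Real.sqrt_pos.2 (hu i), ?_⟩
  simp_rw [Real.sq_sqrt (hu _).le]
  exact hc.summable

/-! ### Fibre decompositions and the transfer of spectral invariants. -/

namespace UnitaryRep

/-- The characters of `G` which are trivial on `H`. -/
abbrev Annihilator {G : Type*} [CommGroup G] [TopologicalSpace G] (H : Subgroup G) : Type _ :=
  {χ : PontryaginDual G // dualRestriction H χ = 1}

section Basic

variable {G : Type*} [CommGroup G] [TopologicalSpace G]
  {E : Type*} [NormedAddCommGroup E] [InnerProductSpace ℂ E] {V : UnitaryRep G E}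

theorem IsSpectralMeasure.smul {x : E} {μ : Measure (PontryaginDual G)}
    (h : V.IsSpectralMeasure x μ) (c : ℂ) :
    V.IsSpectralMeasure (c • x) (ENNReal.ofReal (‖c‖ ^ 2) • μ) := by
  have := h.1
  refine ⟨Measure.smul_finite _ ENNReal.ofReal_ne_top, fun g => ?_⟩
  rw [integral_smul_measure, ← h.2, map_smul, inner_smul_left, inner_smul_right, ← mul_assoc,
    Complex.conj_mul', ENNReal.toReal_ofReal (by positivity), Complex.real_smul]
  push_cast
  rfl

theorem eq_zero_of_forall_inner_eq_zero {x : ℕ → E}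
    (hx : (⨆ n, V.cyclicSubspace (x n)).topologicalClosure = ⊤) {y : E}
    (hy : ∀ n g, inner ℂ (V.toHom g (x n)) y = 0) : y = 0 := by
  have h1 : (⨆ n, V.cyclicSubspace (x n)) ≤ (ℂ ∙ y)ᗮ := iSup_le fun n =>
    V.cyclicSubspace_le (Submodule.isClosed_orthogonal _) fun g =>
      Submodule.mem_orthogonal_singleton_iff_inner_left.2 (hy n g)
  have h2 := Submodule.topologicalClosure_minimal _ h1 (Submodule.isClosed_orthogonal _)
  rw [hx] at h2
  exact inner_self_eq_zero.1
    (Submodule.mem_orthogonal_singleton_iff_inner_left.1 (h2 (Submodule.mem_top (x := y))))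

theorem topologicalClosure_iSup_eq_top [CompleteSpace E] {x : ℕ → E}
    (h : ∀ y : E, (∀ n, ∀ u ∈ V.cyclicSubspace (x n), inner ℂ u y = 0) → y = 0) :
    (⨆ n, V.cyclicSubspace (x n)).topologicalClosure = ⊤ := by
  rw [Submodule.topologicalClosure_eq_top_iff, Submodule.eq_bot_iff]
  intro y hy
  exact h y fun n u hu =>
    (Submodule.mem_orthogonal _ _).1 hy u (Submodule.mem_iSup_of_mem n hu)

end Basic

variable {G : Type*} [CommGroup G] [TopologicalSpace G] {H : Subgroup G}
  {K : Type*} [NormedAddCommGroup K] [InnerProductSpace ℂ K] [CompleteSpace K]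
  {E : Type*} [NormedAddCommGroup E] [InnerProductSpace ℂ E]

/-- A decomposition of a representation `U` of `G` as the orthogonal sum of the representations
`χ ⊗ W`, where `χ` runs over the annihilator of `H` and `W` is an extension of the representation
`V` of `H`, obtained from a Borel section of the restriction map of dual groups. -/
structure FiberDecomposition (U : UnitaryRep G K) (V : UnitaryRep H E) where
  /-- the section -/
  sec : PontryaginDual H → PontryaginDual G
  measurable_sec : Measurable sec
  dualRestriction_sec : ∀ β, dualRestriction H (sec β) = β
  /-- the extension of `V` -/
  ext : UnitaryRep G E
  ext_coe : ∀ (h : H) (x : E), ext.toHom h x = V.toHom h x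
  -- The extension consists of functions of `V`, so it creates no new cyclic subspaces; generators
  -- for `V` and for `U` can thus be compared.
  ext_mem : ∀ (g : G) (x : E), ext.toHom g x ∈ V.cyclicSubspace x
  ext_spectral : ∀ {x : E} {μ : Measure (PontryaginDual H)},
    V.IsSpectralMeasure x μ → ext.IsSpectralMeasure x (μ.map sec)
  /-- the embeddings of the summands -/
  emb : Annihilator H → E →ₗᵢ[ℂ] K
  isHilbertSum : IsHilbertSum ℂ (fun _ => E) emb
  toHom_emb : ∀ (g : G) (χ : Annihilator H) (x : E),
    U.toHom g (emb χ x) = ((χ.1 g : Circle) : ℂ) • emb χ (ext.toHom g x)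

namespace FiberDecomposition

variable {U : UnitaryRep G K} {V : UnitaryRep H E} (d : FiberDecomposition U V)

/-- The component of a vector in the summand with index `χ`. -/
def comp (F : K) (χ : Annihilator H) : E := d.isHilbertSum.linearIsometryEquiv F χ

theorem hasSum_comp (F : K) : HasSum (fun χ => d.emb χ (d.comp F χ)) F := by
  have h := d.isHilbertSum.hasSum_linearIsometryEquiv_symm (d.isHilbertSum.linearIsometryEquiv F)
  rwa [LinearIsometryEquiv.symm_apply_apply] at h

theorem inner_emb_emb_of_ne {χ ψ : Annihilator H} (h : χ ≠ ψ) (x z : E) :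
    inner ℂ (d.emb χ x) (d.emb ψ z) = 0 := d.isHilbertSum.OrthogonalFamily h x z

theorem inner_emb (χ : Annihilator H) (x : E) (F : K) :
    inner ℂ (d.emb χ x) F = inner ℂ x (d.comp F χ) := by
  have h1 : HasSum (fun ψ => inner ℂ (d.emb χ x) (d.emb ψ (d.comp F ψ))) (inner ℂ (d.emb χ x) F) :=
    (d.hasSum_comp F).mapL (innerSL ℂ (d.emb χ x))
  have h2 := hasSum_single (f := fun ψ => inner ℂ (d.emb χ x) (d.emb ψ (d.comp F ψ))) χ
    fun ψ hψ => d.inner_emb_emb_of_ne hψ.symm _ _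
  rw [h1.unique h2, LinearIsometry.inner_map_map]

theorem inner_toHom_emb_emb_of_ne {χ ψ : Annihilator H} (h : χ ≠ ψ) (g : G) (x z : E) :
    inner ℂ (d.emb χ x) (U.toHom g (d.emb ψ z)) = 0 := by
  rw [d.toHom_emb, inner_smul_right, d.inner_emb_emb_of_ne h, mul_zero]

theorem comp_eq_of_forall_inner {F : K} {χ : Annihilator H} {z : E}
    (h : ∀ x, inner ℂ (d.emb χ x) F = inner ℂ x z) : d.comp F χ = z :=
  ext_inner_left ℂ fun x => by rw [← d.inner_emb, h]

theorem eq_zero_of_comp {F : K} (h : ∀ χ, d.comp F χ = 0) : F = 0 := by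
  have h1 := d.hasSum_comp F
  simp only [h, map_zero] at h1
  exact h1.unique hasSum_zero

theorem comp_emb_self (χ : Annihilator H) (x : E) : d.comp (d.emb χ x) χ = x :=
  d.comp_eq_of_forall_inner fun z => by rw [LinearIsometry.inner_map_map]

theorem comp_sub (F F' : K) (χ : Annihilator H) : d.comp (F - F') χ = d.comp F χ - d.comp F' χ :=
  d.comp_eq_of_forall_inner fun z => by
    rw [inner_sub_right, d.inner_emb, d.inner_emb, inner_sub_right]

theorem comp_toHom (g : G) (F : K) (χ : Annihilator H) :
    d.comp (U.toHom g F) χ = ((χ.1 g : Circle) : ℂ) • d.ext.toHom g (d.comp F χ) :=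
  d.comp_eq_of_forall_inner fun z => by
    rw [← (U.toHom g⁻¹).inner_map_map, toHom_inv_apply_self, d.toHom_emb, inner_smul_left,
      d.inner_emb, inner_smul_right, map_inv, Circle.coe_inv_eq_conj, Complex.conj_conj,
      ← (d.ext.toHom g).inner_map_map, ← toHom_mul_apply, mul_inv_cancel, toHom_one_apply]

theorem exists_comp_eq (x : E) {w : Annihilator H → ℝ} (hw : Summable fun χ => w χ ^ 2) :
    ∃ F : K, ∀ χ, d.comp F χ = (w χ : ℂ) • x := by
  have hmem : Memℓp (fun χ : Annihilator H => (w χ : ℂ) • x) 2 := by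
    rw [memℓp_gen_iff (by norm_num)]
    simp only [ENNReal.toReal_ofNat, Real.rpow_ofNat, norm_smul, mul_pow, Complex.norm_real,
      Real.norm_eq_abs, sq_abs]
    exact hw.mul_right _
  refine ⟨d.isHilbertSum.linearIsometryEquiv.symm ⟨_, hmem⟩, fun χ => ?_⟩
  rw [comp, LinearIsometryEquiv.apply_symm_apply]

/-- The Borel section multiplied by a character in the annihilator. -/
def lift (χ : Annihilator H) (β : PontryaginDual H) : PontryaginDual G := χ.1 * d.sec β

theorem dualRestriction_lift (χ : Annihilator H) (β : PontryaginDual H) :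
    dualRestriction H (d.lift χ β) = β := by
  rw [lift, map_mul, χ.2, d.dualRestriction_sec, one_mul]

/-- The image of the Borel section multiplied by a character in the annihilator. -/
def piece (χ : Annihilator H) : Set (PontryaginDual G) := {a | d.lift χ (dualRestriction H a) = a}

theorem exists_mem_piece (a : PontryaginDual G) : ∃ χ, a ∈ d.piece χ := by
  refine ⟨⟨a * (d.sec (dualRestriction H a))⁻¹, ?_⟩, ?_⟩
  · rw [map_mul, map_inv, d.dualRestriction_sec, mul_inv_cancel]
  · exact inv_mul_cancel_right _ _

theorem lift_mem_piece (χ : Annihilator H) (β : PontryaginDual H) : d.lift χ β ∈ d.piece χ := by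
  change d.lift χ (dualRestriction H (d.lift χ β)) = d.lift χ β
  rw [dualRestriction_lift]

theorem lift_notMem_piece {χ ψ : Annihilator H} (h : χ ≠ ψ) (β : PontryaginDual H) :
    d.lift ψ β ∉ d.piece χ := by
  intro h'
  change d.lift χ (dualRestriction H (d.lift ψ β)) = d.lift ψ β at h'
  rw [dualRestriction_lift] at h'
  exact h (Subtype.ext (mul_right_cancel h'))

theorem measurable_lift (χ : Annihilator H) : Measurable (d.lift χ) :=
  (continuous_const.mul continuous_id).measurable.comp d.measurable_sec

theorem _root_.measurable_dualRestriction : Measurable (dualRestriction H) :=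
  (map_continuous (dualRestriction H)).measurable

theorem map_lift_map_dualRestriction (χ : Annihilator H) (μ : Measure (PontryaginDual H)) :
    (μ.map (d.lift χ)).map (dualRestriction H) = μ := by
  rw [Measure.map_map measurable_dualRestriction (d.measurable_lift χ)]
  have : dualRestriction H ∘ d.lift χ = id := funext (d.dualRestriction_lift χ)
  rw [this, Measure.map_id]

theorem isSpectralMeasure_emb {x : E} {μ : Measure (PontryaginDual H)}
    (h : V.IsSpectralMeasure x μ) (χ : Annihilator H) :
    U.IsSpectralMeasure (d.emb χ x) (μ.map (d.lift χ)) := by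
  have := h.1
  refine ⟨inferInstance, fun g => ?_⟩
  have h1 := (d.ext_spectral h).2 g
  rw [integral_map d.measurable_sec.aemeasurable
    (PontryaginDual.measurable_coe_eval_const g).aestronglyMeasurable] at h1
  rw [d.toHom_emb, inner_smul_right, LinearIsometry.inner_map_map, h1,
    integral_map (d.measurable_lift χ).aemeasurable
      (PontryaginDual.measurable_coe_eval_const g).aestronglyMeasurable, ← integral_const_mul]
  rfl

/-- This formula carries the whole transfer: the summands sit on the disjoint pieces, so the
spectral measure of `F` can be read off component by component. -/
theorem isSpectralMeasure_sum (F : K) {μ : Annihilator H → Measure (PontryaginDual H)}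
    (h : ∀ χ, V.IsSpectralMeasure (d.comp F χ) (μ χ)) :
    U.IsSpectralMeasure F (Measure.sum fun χ => (μ χ).map (d.lift χ)) :=
  IsSpectralMeasure.sum (d.hasSum_comp F)
    (fun _ _ hne g => d.inner_toHom_emb_emb_of_ne hne g _ _)
    (fun χ => d.isSpectralMeasure_emb (h χ) χ)

variable [IsTopologicalGroup G] [LocallyCompactSpace G] [SecondCountableTopology G]

theorem measurableSet_piece (χ : Annihilator H) : MeasurableSet (d.piece χ) :=
  measurableSet_eq_fun ((d.measurable_lift χ).comp measurable_dualRestriction) measurable_id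

theorem map_lift_piece_compl (χ : Annihilator H) (μ : Measure (PontryaginDual H)) :
    μ.map (d.lift χ) (d.piece χ)ᶜ = 0 := by
  rw [Measure.map_apply (d.measurable_lift χ) (d.measurableSet_piece χ).compl]
  have : d.lift χ ⁻¹' (d.piece χ)ᶜ = ∅ :=
    Set.eq_empty_of_forall_notMem fun β hβ => hβ (d.lift_mem_piece χ β)
  rw [this, measure_empty]

theorem map_lift_piece_of_ne {χ ψ : Annihilator H} (h : χ ≠ ψ) (μ : Measure (PontryaginDual H)) :
    μ.map (d.lift ψ) (d.piece χ) = 0 := by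
  rw [Measure.map_apply (d.measurable_lift ψ) (d.measurableSet_piece χ)]
  have : d.lift ψ ⁻¹' (d.piece χ) = ∅ :=
    Set.eq_empty_of_forall_notMem fun β hβ => d.lift_notMem_piece h β hβ
  rw [this, measure_empty]

theorem sum_map_lift_restrict_piece (χ : Annihilator H) (μ : Annihilator H → Measure (PontryaginDual H)) :
    (Measure.sum fun ψ => (μ ψ).map (d.lift ψ)).restrict (d.piece χ) = (μ χ).map (d.lift χ) := by
  ext S hS
  rw [Measure.restrict_apply hS, Measure.sum_apply _ (hS.inter (d.measurableSet_piece χ)),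
    tsum_eq_single χ fun ψ hψ =>
      measure_mono_null Set.inter_subset_right (d.map_lift_piece_of_ne hψ.symm (μ ψ)),
    ← Measure.restrict_apply hS, Measure.restrict_eq_self_of_ae_mem]
  exact d.map_lift_piece_compl χ (μ χ)

/-- The components of a vector belong to its cyclic subspace. -/
theorem emb_comp_mem_cyclicSubspace (hV : ∀ x : E, ∃ μ, V.IsSpectralMeasure x μ) (F : K) (χ : Annihilator H) :
    d.emb χ (d.comp F χ) ∈ U.cyclicSubspace F := by
  choose m hm using hV
  -- The remainder has no component at `χ`, so its spectral measure does not charge the piece that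
  -- carries that of the removed component.
  let F' := F - d.emb χ (d.comp F χ)
  have h1 : d.comp F' χ = 0 := by rw [d.comp_sub, d.comp_emb_self, sub_self]
  have h2 := d.isSpectralMeasure_sum F' fun ψ => hm (d.comp F' ψ)
  have h3 := d.isSpectralMeasure_emb (hm (d.comp F χ)) χ
  have h4 := mem_cyclicSubspace_add h3 h2 (d.measurableSet_piece χ)
    (d.map_lift_piece_compl χ _) (by
      have h5 : m (d.comp F' χ) = 0 := by
        rw [← Measure.measure_univ_eq_zero, (hm _).norm_sq, h1]
        simp
      rw [← Measure.restrict_apply_univ, d.sum_map_lift_restrict_piece χ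
        (fun ψ => m (d.comp F' ψ)), h5]
      simp)
  rwa [add_sub_cancel] at h4

/-- By uniqueness `μ` is the sum of the lifted measures; restriction to the piece isolates one
summand, and `π` undoes the lift. -/
theorem isSpectralMeasure_comp (hV : ∀ x : E, ∃ μ, V.IsSpectralMeasure x μ) {F : K}
    {μ : Measure (PontryaginDual G)} (h : U.IsSpectralMeasure F μ) (χ : Annihilator H) :
    V.IsSpectralMeasure (d.comp F χ) ((μ.restrict (d.piece χ)).map (dualRestriction H)) := by
  choose m hm using hV
  rw [h.unique (d.isSpectralMeasure_sum F fun ψ => hm (d.comp F ψ)),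
    d.sum_map_lift_restrict_piece χ (fun ψ => m (d.comp F ψ)), d.map_lift_map_dualRestriction]
  exact hm _

theorem exists_measureEquivalent_sum (x : E) {w : Annihilator H → ℝ} (hw : ∀ χ, 0 < w χ) {F : K}
    (hF : ∀ χ, d.comp F χ = (w χ : ℂ) • x) {μ : Measure (PontryaginDual H)}
    (hμ : V.IsSpectralMeasure x μ) : ∃ μ', U.IsSpectralMeasure F μ' ∧
      MeasureEquivalent μ' (Measure.sum fun χ => μ.map (d.lift χ)) := by
  have h1 : ∀ χ, V.IsSpectralMeasure (d.comp F χ) (ENNReal.ofReal (‖(w χ : ℂ)‖ ^ 2) • μ) :=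
    fun χ => by
      rw [hF]
      exact hμ.smul _
  refine ⟨_, d.isSpectralMeasure_sum F h1, .sum fun χ => MeasureEquivalent.map ?_
    (d.measurable_lift χ)⟩
  refine ⟨Measure.smul_absolutelyContinuous, Measure.absolutelyContinuous_smul ?_⟩
  have h2 : 0 < ‖(w χ : ℂ)‖ ^ 2 := by
    rw [Complex.norm_real, Real.norm_eq_abs, abs_of_pos (hw χ)]
    exact pow_pos (hw χ) 2
  exact (ENNReal.ofReal_pos.2 h2).ne'

/-- The image of a measure of maximal spectral type of `U` restricted to a transversal. -/
theorem isMaximalSpectralType_map_restrict (hV : ∀ x : E, ∃ μ, V.IsSpectralMeasure x μ)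
    {σ : Measure (PontryaginDual G)} (hσ : U.IsMaximalSpectralType σ) (χ : Annihilator H) :
    V.IsMaximalSpectralType ((σ.restrict (d.piece χ)).map (dualRestriction H)) := by
  refine ⟨fun x => ?_, ?_⟩
  · obtain ⟨μ, hμ, hac⟩ := hσ.1 (d.emb χ x)
    have h := d.isSpectralMeasure_comp hV hμ χ
    rw [d.comp_emb_self] at h
    exact ⟨_, h, (hac.restrict _).map measurable_dualRestriction⟩
  · obtain ⟨F, μ, hμ, he⟩ := hσ.2
    exact ⟨_, _, d.isSpectralMeasure_comp hV hμ χ,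
      (he.restrict _).map measurable_dualRestriction⟩

/-- The generators are the `χ`-components of those of `U`. They remain orthogonal because the
embedded components lie in the old cyclic subspaces and `χ` is trivial on `H`. They are total
because `ext` maps each component into its own `V`-cyclic subspace. -/
theorem isMultiplicityFunction_comp_lift (hV : ∀ x : E, ∃ μ, V.IsSpectralMeasure x μ)
    [CompleteSpace E] {σ : Measure (PontryaginDual G)} {l : PontryaginDual G → ℕ∞}
    (hl : U.IsMultiplicityFunction σ l) (χ : Annihilator H) :
    V.IsMultiplicityFunction ((σ.restrict (d.piece χ)).map (dualRestriction H))
      (l ∘ d.lift χ) := by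
  obtain ⟨hlm, z, horth, htot, hz⟩ := hl
  have hmem := fun n => d.emb_comp_mem_cyclicSubspace hV (z n) χ
  have hmem' : ∀ n (h : H), d.emb χ (V.toHom h (d.comp (z n) χ)) ∈ U.cyclicSubspace (z n) := by
    intro n h
    have h1 := U.toHom_mem_cyclicSubspace (hmem n) h
    have h2 : χ.1 (h : G) = 1 := dualRestriction_eq_one_iff.1 χ.2 h
    rwa [d.toHom_emb, h2, Circle.coe_one, one_smul, d.ext_coe] at h1
  refine ⟨hlm.comp (d.measurable_lift χ), fun n => d.comp (z n) χ, fun m n hmn => ?_, ?_,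
    fun n => ?_⟩
  · refine V.cyclicSubspace_isOrtho fun h h' => ?_
    rw [← (d.emb χ).inner_map_map]
    exact Submodule.isOrtho_iff_inner_eq.1 (horth hmn) _ (hmem' m h) _ (hmem' n h')
  · refine topologicalClosure_iSup_eq_top fun y hy => ?_
    refine (map_eq_zero_iff (d.emb χ) (d.emb χ).injective).1
      (eq_zero_of_forall_inner_eq_zero htot fun n g => ?_)
    rw [inner_eq_zero_symm, d.inner_emb, d.comp_toHom, inner_smul_right,
      inner_eq_zero_symm.1 (hy n _ (d.ext_mem g _)), mul_zero]
  · obtain ⟨μ, hμ, he⟩ := hz n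
    refine ⟨_, d.isSpectralMeasure_comp hV hμ χ, ?_⟩
    have hS : MeasurableSet {a | (n : ℕ∞) < l a} := hlm (.of_discrete (s := Set.Ioi (n : ℕ∞)))
    have hS' : MeasurableSet {β | (n : ℕ∞) < (l ∘ d.lift χ) β} :=
      (hlm.comp (d.measurable_lift χ)) (.of_discrete (s := Set.Ioi (n : ℕ∞)))
    rw [Measure.restrict_map measurable_dualRestriction hS',
      Measure.restrict_restrict (measurable_dualRestriction hS')]
    -- On the piece, lifting inverts restriction, so both descriptions of the multiplicity agree
    -- there.
    have hset : dualRestriction H ⁻¹' {β | (n : ℕ∞) < (l ∘ d.lift χ) β} ∩ d.piece χ =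
        d.piece χ ∩ {a | (n : ℕ∞) < l a} := by
      ext a
      have h1 : a ∈ d.piece χ → l (d.lift χ (dualRestriction H a)) = l a := fun ha =>
        congrArg l ha
      constructor
      · rintro ⟨ha1, ha2⟩
        exact ⟨ha2, by simpa [h1 ha2] using ha1⟩
      · rintro ⟨ha1, ha2⟩
        exact ⟨by simpa [h1 ha1] using ha2, ha1⟩
    rw [hset, ← Measure.restrict_restrict (d.measurableSet_piece χ)]
    exact (he.restrict _).map measurable_dualRestriction

/-- Each generator `x n` of `V` is spread over all summands with positive square-summable weights.
Its spectral measure then has the class of the sum of all lifts, and one vector generates every copy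
of its cyclic subspace. -/
theorem subset_spectralMultiplicities [Countable (Annihilator H)] (d : FiberDecomposition U V) :
    V.spectralMultiplicities ⊆ U.spectralMultiplicities := by
  rintro k ⟨σ, l, hσ, ⟨hlm, x, horth, htot, hx⟩, hk⟩
  have hV : ∀ x : E, ∃ μ, V.IsSpectralMeasure x μ := fun x => (hσ.1 x).imp fun _ h => h.1
  obtain ⟨w, hw, hws⟩ := exists_pos_summable_sq (Annihilator H)
  have hlm' : Measurable (l ∘ dualRestriction H) := hlm.comp measurable_dualRestriction
  choose z hz using fun n => d.exists_comp_eq (x n) hws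
  refine ⟨Measure.sum fun χ => σ.map (d.lift χ), l ∘ dualRestriction H, ⟨fun F => ?_, ?_⟩,
    ⟨hlm', z, fun m n hmn => ?_, ?_, fun n => ?_⟩, ?_⟩
  · choose m hm hac using hσ.1
    exact ⟨_, d.isSpectralMeasure_sum F fun χ => hm (d.comp F χ),
      .sum fun χ => (hac _).map (d.measurable_lift χ)⟩
  · obtain ⟨y, μ, hμ, he⟩ := hσ.2
    obtain ⟨F, hF⟩ := d.exists_comp_eq y hws
    obtain ⟨μ', hμ', he'⟩ := d.exists_measureEquivalent_sum y hw hF hμ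
    have he'' : MeasureEquivalent (Measure.sum fun χ => μ.map (d.lift χ))
        (Measure.sum fun χ => σ.map (d.lift χ)) := .sum fun χ => he.map (d.measurable_lift χ)
    exact ⟨F, μ', hμ', he'.1.trans he''.1, he''.2.trans he'.2⟩
  · refine U.cyclicSubspace_isOrtho fun g g' => ?_
    have h1 : HasSum (fun χ => inner ℂ (U.toHom g' (z n))
        (d.emb χ (d.comp (U.toHom g (z m)) χ))) (inner ℂ (U.toHom g' (z n)) (U.toHom g (z m))) :=
      (d.hasSum_comp _).mapL (innerSL ℂ (U.toHom g' (z n)))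
    have h2 : ∀ χ, inner ℂ (U.toHom g' (z n)) (d.emb χ (d.comp (U.toHom g (z m)) χ)) = 0 := by
      intro χ
      rw [inner_eq_zero_symm, d.inner_emb, d.comp_toHom, d.comp_toHom, hz, hz, map_smul, map_smul,
        inner_smul_left, inner_smul_left, inner_smul_right, inner_smul_right,
        Submodule.isOrtho_iff_inner_eq.1 (horth hmn) _ (d.ext_mem g _) _ (d.ext_mem g' _)]
      simp
    simp only [h2] at h1
    rw [inner_eq_zero_symm]
    exact h1.unique hasSum_zero
  -- The cyclic subspace of `z n` contains its component at `χ`, and dividing by the nonzero weight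
  -- recovers `emb χ (x n)`. So each component of `F` is orthogonal to all `V`-cyclic subspaces.
  · refine topologicalClosure_iSup_eq_top fun F hF => d.eq_zero_of_comp fun χ => ?_
    refine eq_zero_of_forall_inner_eq_zero htot fun n h => ?_
    rw [← d.inner_emb]
    refine hF n _ ?_
    have h1 := d.emb_comp_mem_cyclicSubspace hV (z n) χ
    rw [hz, map_smul] at h1
    have hw0 : (w χ : ℂ) ≠ 0 := by exact_mod_cast (hw χ).ne'
    have h2 := U.toHom_mem_cyclicSubspace ((Submodule.smul_mem_iff _ hw0).1 h1) h
    have h3 : χ.1 (h : G) = 1 := dualRestriction_eq_one_iff.1 χ.2 h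
    rwa [d.toHom_emb, h3, Circle.coe_one, one_smul, d.ext_coe] at h2
  · obtain ⟨μ, hμ, he⟩ := hx n
    obtain ⟨μ', hμ', he'⟩ := d.exists_measureEquivalent_sum (x n) hw (hz n) hμ
    have hS : MeasurableSet {a | (n : ℕ∞) < (l ∘ dualRestriction H) a} := hlm' (.of_discrete (s := Set.Ioi (n : ℕ∞)))
    have he'' : MeasureEquivalent (Measure.sum fun χ => μ.map (d.lift χ))
        (Measure.sum fun χ => (σ.restrict {β | (n : ℕ∞) < l β}).map (d.lift χ)) :=
      .sum fun χ => he.map (d.measurable_lift χ)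
    have heq : (Measure.sum fun χ => (σ.restrict {β | (n : ℕ∞) < l β}).map (d.lift χ)) =
        (Measure.sum fun χ => σ.map (d.lift χ)).restrict
          {a | (n : ℕ∞) < (l ∘ dualRestriction H) a} := by
      rw [Measure.restrict_sum _ hS]
      congr 1
      ext1 χ
      rw [Measure.restrict_map (d.measurable_lift χ) hS]
      congr 2
      ext β
      change _ ↔ (n : ℕ∞) < l (dualRestriction H (d.lift χ β))
      rw [d.dualRestriction_lift]
      rfl
    rw [← heq]
    exact ⟨μ', hμ', he'.1.trans he''.1, he''.2.trans he'.2⟩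
  · have hS : MeasurableSet {a | (l ∘ dualRestriction H) a = k} :=
      hlm' (measurableSet_singleton k)
    intro h0
    rw [Measure.sum_apply _ hS, ENNReal.tsum_eq_zero] at h0
    have h1 := h0 ⟨1, map_one _⟩
    rw [Measure.map_apply (d.measurable_lift _) hS] at h1
    refine hk (measure_mono_null (fun β hβ => ?_) h1)
    change l (dualRestriction H (d.lift _ β)) = k
    rw [d.dualRestriction_lift]
    exact hβ

/-- Countably many pieces cover the dual of `G`, so a level set of positive measure meets one of
them in positive measure, and that piece carries a copy of `V`. -/
theorem spectralMultiplicities_subset (d : FiberDecomposition U V) [CompleteSpace E] [Countable (Annihilator H)]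
    (hV : ∀ x : E, ∃ μ, V.IsSpectralMeasure x μ) :
    U.spectralMultiplicities ⊆ V.spectralMultiplicities := by
  rintro k ⟨σ, l, hσ, hl, hk⟩
  have hlm := hl.1
  obtain ⟨χ, hχ⟩ : ∃ χ, σ ({a | l a = k} ∩ d.piece χ) ≠ 0 := by
    by_contra! h
    refine hk (measure_mono_null (fun a ha => ?_) (measure_iUnion_null h))
    obtain ⟨χ, hχ⟩ := d.exists_mem_piece a
    exact Set.mem_iUnion.2 ⟨χ, ha, hχ⟩
  refine ⟨_, _, d.isMaximalSpectralType_map_restrict hV hσ χ,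
    d.isMultiplicityFunction_comp_lift hV hl χ, ?_⟩
  have hS : MeasurableSet {β | (l ∘ d.lift χ) β = k} :=
    (hlm.comp (d.measurable_lift χ)) (measurableSet_singleton k)
  rw [Measure.map_apply measurable_dualRestriction hS,
    Measure.restrict_apply (measurable_dualRestriction hS)]
  refine fun h0 => hχ (measure_mono_null ?_ h0)
  rintro a ⟨ha, haχ⟩
  refine ⟨?_, haχ⟩
  change l (d.lift χ (dualRestriction H a)) = k
  rw [show d.lift χ (dualRestriction H a) = a from haχ]
  exact ha

variable [LocallyCompactSpace H] [SecondCountableTopology H]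

variable [Countable (Annihilator H)]

/-- A measure of maximal spectral type of `U` and its restriction to a transversal have equivalent
images. -/
theorem measureEquivalent_map_restrict (hV : ∀ x : E, ∃ μ, V.IsSpectralMeasure x μ)
    {σ : Measure (PontryaginDual G)} (hσ : U.IsMaximalSpectralType σ) (χ : Annihilator H) :
    MeasureEquivalent ((σ.restrict (d.piece χ)).map (dualRestriction H))
      (σ.map (dualRestriction H)) := by
  refine ⟨Measure.restrict_le_self.absolutelyContinuous.map measurable_dualRestriction,
    Measure.AbsolutelyContinuous.mk fun S hS h0 => ?_⟩
  rw [Measure.map_apply measurable_dualRestriction hS]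
  obtain ⟨F, μ, hμ, he⟩ := hσ.2
  refine he.2 ?_
  have hcov : dualRestriction H ⁻¹' S ⊆ ⋃ ψ, dualRestriction H ⁻¹' S ∩ d.piece ψ := by
    intro a ha
    obtain ⟨ψ, hψ⟩ := d.exists_mem_piece a
    exact Set.mem_iUnion.2 ⟨ψ, ha, hψ⟩
  refine measure_mono_null hcov (measure_iUnion_null fun ψ => ?_)
  rw [← Measure.restrict_apply (measurable_dualRestriction hS)]
  rw [← Measure.map_apply measurable_dualRestriction hS]
  -- The part of `μ` over any other piece `ψ` projects to the spectral measure of a component of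
  -- `F`, which is dominated by the maximal spectral type of `V` read off at `χ`.
  obtain ⟨μ', hμ', hac⟩ := (d.isMaximalSpectralType_map_restrict hV hσ χ).1 (d.comp F ψ)
  rw [(d.isSpectralMeasure_comp hV hμ ψ).unique hμ']
  exact hac h0

theorem isMaximalSpectralType_map (d : FiberDecomposition U V) (hV : ∀ x : E, ∃ μ, V.IsSpectralMeasure x μ)
    {σ : Measure (PontryaginDual G)} (hσ : U.IsMaximalSpectralType σ) :
    V.IsMaximalSpectralType (σ.map (dualRestriction H)) := by
  let χ : Annihilator H := ⟨1, map_one _⟩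
  obtain ⟨h1, x, μ, hμ, h2⟩ := d.isMaximalSpectralType_map_restrict hV hσ χ
  have he := d.measureEquivalent_map_restrict hV hσ χ
  refine ⟨fun x => ?_, x, μ, hμ, h2.1.trans he.1, he.2.trans h2.2⟩
  obtain ⟨μ, hμ, hac⟩ := h1 x
  exact ⟨μ, hμ, hac.trans he.1⟩

end FiberDecomposition

/-! ### Application to the induced representation. -/

section Main

variable {G : Type*} [CommGroup G] [TopologicalSpace G] [MeasurableSpace G] {H : Subgroup G}
  [IsTopologicalGroup G] [LocallyCompactSpace G] [SecondCountableTopology G] [T2Space G]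
  [BorelSpace G] [IsClosed (H : Set G)] [CompactSpace (G ⧸ H)]
  (ν : Measure (G ⧸ H)) [ν.IsHaarMeasure] (s : BorelCrossSection H)
  {E : Type*} [NormedAddCommGroup E] [InnerProductSpace ℂ E]
  [TopologicalSpace.SeparableSpace E] {V : UnitaryRep H E}

theorem nonempty_fiberDecomposition [CompleteSpace E] [LocallyCompactSpace H] [SecondCountableTopology H]
    (hV : ∀ x : E, ∃ μ, V.IsSpectralMeasure x μ) :
    Nonempty (FiberDecomposition (induced ν s V) V) := by
  obtain ⟨t, ht, htr⟩ := exists_measurable_section_dualRestriction H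
    (dualRestriction_surjective s ν)
  have hcoe : ∀ (h : H) (x : E), (transport hV t ht).toHom h x = V.toHom h x := fun h x =>
    transport_toHom_of_eval_eq hV ht
      (fun χ => by rw [← dualRestriction_apply, htr]) x
  exact ⟨{
    sec := t
    measurable_sec := ht
    dualRestriction_sec := htr
    ext := transport hV t ht
    ext_coe := hcoe
    ext_mem := fun g x => transport_mem_cyclicSubspace hV ht g x
    ext_spectral := fun h => h.transport hV ht
    emb := fun χ => embedding s _ ν χ
    isHilbertSum := isHilbertSum_embedding s _ ν
    toHom_emb := fun g χ x => induced_embedding s _ ν V hcoe χ.2 g x }⟩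

/-- If all vectors of the induced representation have spectral measures, then so do all vectors of
the inducing representation. -/
theorem exists_isSpectralMeasure_of_induced
    (hU : ∀ F, ∃ μ, (induced ν s V).IsSpectralMeasure F μ) (x : E) :
    ∃ μ, V.IsSpectralMeasure x μ := by
  -- On a constant function `H` acts pointwise by `V`. The spectral measure of this function,
  -- projected to the dual of `H` and divided by the mass of `G ⧸ H`, is that of `x`.
  have hmem : MemLp (fun _ : G ⧸ H => x) 2 ν := memLp_const x
  obtain ⟨μ, hμ, h⟩ := hU (hmem.toLp _)
  have hpos := measureReal_univ_pos (H := H) ν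
  refine ⟨ENNReal.ofReal (ν.real Set.univ)⁻¹ • μ.map (dualRestriction H),
    Measure.smul_finite _ ENNReal.ofReal_ne_top, fun g => ?_⟩
  have h1 : inner ℂ (hmem.toLp _) ((induced ν s V).toHom g (hmem.toLp _)) =
      (ν.real Set.univ : ℂ) * inner ℂ x (V.toHom g x) := by
    rw [L2.inner_def]
    have h2 : ∫ y : G ⧸ H, inner ℂ x (V.toHom g x) ∂ν =
        (ν.real Set.univ : ℂ) * inner ℂ x (V.toHom g x) := by
      rw [integral_const, Complex.real_smul]
    rw [← h2]
    refine integral_congr_ae ?_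
    filter_upwards [coeFn_induced_coe s ν V g (hmem.toLp _), hmem.coeFn_toLp] with y h3 h4
    rw [h3, h4]
  rw [integral_smul_measure, integral_map measurable_dualRestriction.aemeasurable
    (PontryaginDual.measurable_coe_eval_const g).aestronglyMeasurable,
    ENNReal.toReal_ofReal (by positivity)]
  have h5 := h g
  rw [h1] at h5
  change _ = _ • ∫ a, ((a (g : G) : Circle) : ℂ) ∂μ
  rw [← h5, Complex.real_smul, Complex.ofReal_inv, inv_mul_cancel_left₀]
  exact_mod_cast hpos.ne'

end Main

end UnitaryRep

end

theorem proposition1p1 {G : Type*} [CommGroup G] [TopologicalSpace G] [IsTopologicalGroup G]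
    [LocallyCompactSpace G] [SecondCountableTopology G] [T2Space G]
    [MeasurableSpace G] [BorelSpace G]
    (H : Subgroup G) [IsClosed (H : Set G)] [CompactSpace (G ⧸ H)]
    (ν : MeasureTheory.Measure (G ⧸ H)) [ν.IsHaarMeasure]
    (s : BorelCrossSection H)
    {E : Type*} [NormedAddCommGroup E] [InnerProductSpace ℂ E] [CompleteSpace E]
    [TopologicalSpace.SeparableSpace E]
    (V : UnitaryRep H E) :
    (∀ σ : MeasureTheory.Measure (PontryaginDual G),
      (UnitaryRep.induced ν s V).IsMaximalSpectralType σ →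
        V.IsMaximalSpectralType (σ.map (dualRestriction H))) ∧
    (UnitaryRep.induced ν s V).spectralMultiplicities = V.spectralMultiplicities := by
  have : LocallyCompactSpace H := (IsClosed.isClosedEmbedding_subtypeVal ‹_›).locallyCompactSpace
  have : SecondCountableTopology H := TopologicalSpace.Subtype.secondCountableTopology _
  have := countable_dualRestriction_eq_one H
  -- A measure of maximal spectral type comes with spectral measures of all vectors; this is the
  -- only source of their existence for `U`.
  have hUV : ∀ σ, (UnitaryRep.induced ν s V).IsMaximalSpectralType σ →
      ∀ x : E, ∃ μ, V.IsSpectralMeasure x μ := fun σ hσ =>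
    UnitaryRep.exists_isSpectralMeasure_of_induced ν s fun F => (hσ.1 F).imp fun _ h => h.1
  refine ⟨fun σ hσ => ?_, Set.Subset.antisymm (fun k hk => ?_) fun k hk => ?_⟩
  · obtain ⟨d⟩ := UnitaryRep.nonempty_fiberDecomposition ν s (hUV σ hσ)
    exact d.isMaximalSpectralType_map (hUV σ hσ) hσ
  · have hV := hUV _ hk.choose_spec.choose_spec.1
    obtain ⟨d⟩ := UnitaryRep.nonempty_fiberDecomposition ν s hV
    exact d.spectralMultiplicities_subset hV hk
  · obtain ⟨d⟩ := UnitaryRep.nonempty_fiberDecomposition ν s fun x =>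
      (hk.choose_spec.choose_spec.1.1 x).imp fun _ h => h.1
    exact d.subset_spectralMultiplicities hk
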